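/- Let $d\ge 3$, let $\kappa_d=\pi^{d/2}/\Gamma(d/2+1)$ be the volume of the unit ball of $\mathbb{R}^d$, let $m_d$ be Lebesgue measure, and let $\sigma$ be the surface measure on the unit sphere $\mathbb{S}^{d-1}$. For $\Omega:\mathbb{S}^{d-1}\to\mathbb{R}$ put $K(x)=\Omega(x/|x|)\,|x|^{-(d-2)}$, $x\neq 0$. For $B>1$, a *construction with parameter $B$* consists of the following. - Radii $r_0=1$, $r_k>0$ with $r_{k+1}<r_k/B$, $r_k/r_{k+1}\in\mathbb{N}$ and $1/r_k\in\mathbb{N}$ for all $k\ge 0$. Put $\delta_{k+1}=\sqrt d\,\kappa_d^{1/d}\,(r_{k+1}/r_k)^{(d-2)/d}$. - Finite sets $Z_k\subset\mathbb{R}^d$ of centers with $Z_0=\{0\}$. For every $z\in Z_k$ one chooses $(r_k/r_{k+1})^{d-2}$ pairwise essentially disjoint closed axis-parallel cubes of side length $(\kappa_d r_{k+1}^{d-2}r_k^2)^{1/d}$, all contained in the closed ball $\overline{B}(z,(1+\delta_{k+1})r_k)$, and $Z_{k+1}$ is the set of the centers of all these cubes, for all $z\in Z_k$. Let $\mu^k=\sum_{z\in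 Z_k} r_k^{-2}\chi_{\overline{B}(z,r_k)}\,m_d$, and let $\mu$ be a finite Borel measure that is the weak limit of a subsequence of $(\mu^k)$. **Proposition.** There is a constant $B=B(d)>1$ such that for all $\alpha\in(0,1]$, $H\ge 0$ and $S\in\mathbb{R}$ there is a constant $C=C(d,\alpha,H,S)>0$ with the following property. Let $\Omega:\mathbb{S}^{d-1}\to\mathbb{R}$ be even, with $|\Omega(\omega)-\Omega(\xi)|\le H|\omega-\xi|^\alpha$ for all $\omega,\xi\in\mathbb{S}^{d-1}$, with $\int_{\mathbb{S}^{d-1}}\Omega\,d\sigma=0$ and $$\int_{\mathbb{S}^{d-1}}\xi_i\,\xi_j\,\Omega(\xi)\,d\sigma(\xi)=0\quad\text{for all } i,j\in\{1,\dots,d\}.$$ Consider any construction with parameter $B$ such that $\sum_{k\ge1}\delta_k^{2\alpha/d}$ converges with sum at most $S$, and any $\mu$ as above. Then: 1. if $\operatorname{dist}(x,\operatorname{supp}\mu)=\epsilon>0$ and $m\ge 0$ is such that $r_m<\epsilon/(2d)$, then $\zeta\mapsto K(x-\zeta)$ is $\mu^m$-integrable and $\left|\int K(x-\zeta)\,d\mu^m(\zeta)\right|\le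 C$; 2. consequently the potential of $\mu$ is bounded off $\operatorname{supp}\mu$: for every $x\notin\operatorname{supp}\mu$ the function $\zeta\mapsto K(x-\zeta)$ is $\mu$-integrable and $\left|\int K(x-\zeta)\,d\mu(\zeta)\right|\le C$. -/

import Mathlib

open MeasureTheory Filter Topology Metric
open scoped NNReal BoundedContinuousFunction

noncomputable section

namespace EvenSIO

/-- Euclidean space of dimension `d`. -/
abbrev E (d : ℕ) : Type := EuclideanSpace ℝ (Fin d)

/-- The `(d - 2)`-homogeneous kernel `K(x) = Ω(x / |x|) / |x|^(d-2)`. Only the values of `Ω` on the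
unit sphere matter; for `d ≥ 3` the value at `x = 0` is `0`. -/
def kernel (d : ℕ) (Ω : E d → ℝ) (x : E d) : ℝ :=
  Ω (‖x‖⁻¹ • x) / ‖x‖ ^ (d - 2)

/-- Surface area measure on the unit sphere of `ℝ^d`. -/
def surface (d : ℕ) : Measure (sphere (0 : E d) 1) :=
  (volume : Measure (E d)).toSphere

/-- `Ω` is even on the unit sphere. -/
def EvenOnSphere (d : ℕ) (Ω : E d → ℝ) : Prop :=
  ∀ ξ ∈ sphere (0 : E d) 1, Ω (-ξ) = Ω ξ

/-- `Ω` has mean zero on the unit sphere. -/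
def MeanZero (d : ℕ) (Ω : E d → ℝ) : Prop :=
  ∫ ξ : sphere (0 : E d) 1, Ω (ξ : E d) ∂(surface d) = 0

/-- All second moments of `Ω` over the unit sphere vanish. -/
def MomentCondition (d : ℕ) (Ω : E d → ℝ) : Prop :=
  ∀ i j : Fin d,
    ∫ ξ : sphere (0 : E d) 1, (ξ : E d) i * (ξ : E d) j * Ω (ξ : E d) ∂(surface d) = 0

/-- The volume of the unit ball of `ℝ^d`. -/
def kappa (d : ℕ) : ℝ :=
  Real.pi ^ ((d : ℝ) / 2) / Real.Gamma ((d : ℝ) / 2 + 1)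

/-- The side length of the cubes used to pack a ball of radius `R`, when the next generation
has radius `ρ`: the `d`-th root of `κ_d ρ^(d-2) R^2`. -/
def sideLength (d : ℕ) (ρ R : ℝ) : ℝ :=
  (kappa d * ρ ^ (d - 2) * R ^ 2) ^ (1 / (d : ℝ))

/-- The closed axis-parallel cube with center `c` and side length `l`. -/
def cube (d : ℕ) (c : E d) (l : ℝ) : Set (E d) :=
  {x | ∀ i, |x i - c i| ≤ l / 2}

/-- `deltaSucc d r k` is `δ_{k+1} = A (r_{k+1}^(d-2) / r_k^(d-2))^(1/d)`, where
`A = d^(1/2) κ_d^(1/d)`. -/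
def deltaSucc (d : ℕ) (r : ℕ → ℝ) (k : ℕ) : ℝ :=
  Real.sqrt d * kappa d ^ (1 / (d : ℝ)) *
    (r (k + 1) ^ (d - 2) / r k ^ (d - 2)) ^ (1 / (d : ℝ))

open Classical in
/-- The centers of the balls of generation `k`: generation `0` is the origin, and generation
`k + 1` consists of the children of the points of generation `k`. -/
def centersOf (d : ℕ) (children : ℕ → E d → Finset (E d)) : ℕ → Finset (E d)
  | 0 => {0}
  | k + 1 => (centersOf d children k).biUnion (children k)

/-- The iterative construction: radii `r_k` decreasing by a factor of more than `B` at each step,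
and, for every ball of generation `k` with center `z`, a packing of `(r_k / r_{k+1})^(d-2)`
pairwise essentially disjoint cubes of side length `(κ_d r_{k+1}^(d-2) r_k^2)^(1/d)` in the ball
of radius `(1 + δ_{k+1}) r_k` about `z`. The centers of the cubes are the centers of the balls of
generation `k + 1`. -/
structure Construction (d : ℕ) (B : ℝ) where
  r : ℕ → ℝ
  children : ℕ → E d → Finset (E d)
  r_zero : r 0 = 1
  r_pos : ∀ k, 0 < r k
  r_lt : ∀ k, r (k + 1) < r k / B
  ratio_nat : ∀ k, ∃ q : ℕ, r k / r (k + 1) = q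
  inv_nat : ∀ k, ∃ q : ℕ, 1 / r k = q
  card_children : ∀ k, ∀ z ∈ centersOf d children k,
    ((children k z).card : ℝ) = (r k / r (k + 1)) ^ (d - 2)
  disjoint_cubes : ∀ k, ∀ z ∈ centersOf d children k,
    ∀ c ∈ children k z, ∀ c' ∈ children k z, c ≠ c' →
      AEDisjoint volume (cube d c (sideLength d (r (k + 1)) (r k)))
        (cube d c' (sideLength d (r (k + 1)) (r k)))
  cube_subset : ∀ k, ∀ z ∈ centersOf d children k, ∀ c ∈ children k z,
    cube d c (sideLength d (r (k + 1)) (r k)) ⊆ closedBall z ((1 + deltaSucc d r k) * r k)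

namespace Construction

variable {d : ℕ} {B : ℝ}

/-- The centers of the balls of generation `k`. -/
def centers (P : Construction d B) (k : ℕ) : Finset (E d) :=
  centersOf d P.children k

/-- The `k`-th approximating measure: the sum over the balls of generation `k` of Lebesgue measure
on the ball, divided by `r_k^2`. -/
def approx (P : Construction d B) (k : ℕ) : Measure (E d) :=
  ∑ z ∈ P.centers k, ENNReal.ofReal (1 / P.r k ^ 2) • volume.restrict (closedBall z (P.r k))

/-- `μ` is the weak limit of a subsequence of the approximating measures. -/
def IsWeakLimit (P : Construction d B) (μ : Measure (E d)) : Prop :=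
  ∃ φ : ℕ → ℕ, StrictMono φ ∧ ∀ f : E d →ᵇ ℝ,
    Tendsto (fun n => ∫ x, f x ∂(P.approx (φ n))) atTop (𝓝 (∫ x, f x ∂μ))

end Construction

end EvenSIO

end

/-!
The bound comes from one cancellation: if `x` lies in a closed ball, the potential at `x` of
Lebesgue measure on this ball is zero (`integral_closedBall_kernel_eq_zero`). In polar coordinates
about `x` the potential is the integral over the sphere of `Ω(ω) ρ(ω)² / 2`, where `ρ(ω)` is the
distance from `x` to the boundary in the direction `ω`; the sum of `ρ(ω)²` and `ρ(-ω)²` is a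
quadratic polynomial in `ω`, and `Ω` is even and orthogonal to constants and to quadratic
monomials.

The measure `approx m` is organized as a tree: `treeMeasure n k z` is the measure carried, `n`
generations later, by the descendants of the ball of generation `k` about `z`. It has mass `κ_d
r_k^(d-2)` and lies in the ball of radius `2 r_k`, so a ball at distance at least `3 r_k` from `x`
contributes a bounded amount whatever happens further down (`abs_integral_kernel_far_le`).

If `x` is close to the ball about `z`, let `c₀` be the child of `z` nearest to `x`. All other
children are at distance at least `l / 2` from `x`, where `l` is the side length of the cubes,
because the cubes are disjoint. Comparing masses with integrals over cubes shows that the other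
children contribute a bounded amount (`abs_sum_children_le`). If `x` is also close to `c₀`, then
it lies in a slightly enlarged ball about `z`, and the other children contribute only
`O(δ_{k+1}^(2α/d))` (`abs_sum_erase_le`): replacing each child by the uniform measure on its cube
costs `(l / r_k)^α ≲ δ_{k+1}^α` by the Hölder continuity of the kernel; the nearest cube costs
`δ_{k+1}^2`; and the union of all cubes differs from the enlarged ball, whose potential at `x`
vanishes, by a set of volume `≲ δ_{k+1} r_k^d`, whose potential is `≲ δ_{k+1}^(2/d) r_k^2`
(`integral_norm_rpow_le`).

Hence one may descend along the chain of nearest children as long as `x` stays close to them, pay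
`O(δ_{k+1}^(2α/d))` per generation and a bounded amount at the end
(`abs_integral_treeMeasure_kernel_le`). The descent stops before generation `m`, since every ball
of the construction is close to the support of the limit measure (`exists_mem_support`). The bound
is uniform in `m` and passes to the weak limit, because off the support the kernel agrees with a
bounded continuous function.
-/

noncomputable section

namespace EvenSIO

/-! ### Volumes of balls and cubes, and the scales of the construction -/

section

variable {d : ℕ}

lemma kappa_pos (d : ℕ) : 0 < kappa d := by
  unfold kappa
  have : 0 < Real.Gamma ((d : ℝ) / 2 + 1) := Real.Gamma_pos_of_pos (by positivity)
  positivity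

lemma volume_closedBall_eq (hd : 0 < d) (x : E d) {R : ℝ} (hR : 0 ≤ R) :
    volume (closedBall x R) = ENNReal.ofReal (kappa d * R ^ d) := by
  have : Nonempty (Fin d) := ⟨⟨0, hd⟩⟩
  rw [EuclideanSpace.volume_closedBall, Fintype.card_fin, ← ENNReal.ofReal_pow hR,
    ← ENNReal.ofReal_mul (by positivity), mul_comm]
  congr 3
  rw [Real.sqrt_eq_rpow, ← Real.rpow_natCast, ← Real.rpow_mul Real.pi_pos.le]
  congr 1
  ring

lemma isClosed_cube (c : E d) (l : ℝ) : IsClosed (cube d c l) := by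
  simp only [cube, Set.ofPred_forall]
  exact isClosed_iInter fun i => isClosed_le (by fun_prop) continuous_const

lemma volume_cube (c : E d) {l : ℝ} (hl : 0 ≤ l) :
    volume (cube d c l) = ENNReal.ofReal (l ^ d) := by
  have h : cube d c l =
      (WithLp.ofLp : E d → (Fin d → ℝ)) ⁻¹'
        Set.Icc (fun i => c i - l / 2) (fun i => c i + l / 2) := by
    ext x
    simp only [cube, Set.mem_ofPred_eq, Set.mem_preimage, Set.mem_Icc, Pi.le_def, abs_le]
    constructor
    · intro h
      exact ⟨fun i => by linarith [(h i).1], fun i => by linarith [(h i).2]⟩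
    · rintro ⟨h1, h2⟩ i
      exact ⟨by linarith [h1 i], by linarith [h2 i]⟩
  rw [h, (PiLp.volume_preserving_ofLp (Fin d)).measure_preimage
    measurableSet_Icc.nullMeasurableSet, Real.volume_Icc_pi]
  simp only [add_sub_sub_cancel, add_halves, Finset.prod_const, Finset.card_univ,
    Fintype.card_fin]
  rw [ENNReal.ofReal_pow hl]

lemma norm_sub_le_of_mem_cube {c x : E d} {l : ℝ} (hx : x ∈ cube d c l) :
    ‖x - c‖ ≤ √d * l / 2 := by
  rcases Nat.eq_zero_or_pos d with rfl | hd
  · simp [EuclideanSpace.norm_eq]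
  have hl : 0 ≤ l / 2 := (abs_nonneg _).trans (hx ⟨0, hd⟩)
  rw [EuclideanSpace.norm_eq, mul_div_assoc]
  calc √(∑ i, ‖(x - c) i‖ ^ 2) ≤ √(∑ _i : Fin d, (l / 2) ^ 2) := by
        apply Real.sqrt_le_sqrt
        refine Finset.sum_le_sum fun i _ => ?_
        have := hx i
        rw [PiLp.sub_apply, Real.norm_eq_abs]
        gcongr
    _ = √d * (l / 2) := by
        rw [Finset.sum_const, Finset.card_univ, Fintype.card_fin, nsmul_eq_mul,
          Real.sqrt_mul (by positivity), Real.sqrt_sq hl]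

lemma center_mem_cube (c : E d) {l : ℝ} (hl : 0 ≤ l) : c ∈ cube d c l := by
  intro i
  simp only [sub_self, abs_zero]
  positivity

/-- Centers of essentially disjoint cubes of side length `l` are at distance at least `l`. -/
lemma le_norm_sub_of_aedisjoint_cube {c c' : E d} {l : ℝ}
    (h : AEDisjoint volume (cube d c l) (cube d c' l)) : l ≤ ‖c - c'‖ := by
  by_contra! hlt
  -- Otherwise a ball around the midpoint lies in both cubes.
  have hsub : ball (midpoint ℝ c c') ((l - ‖c - c'‖) / 2) ⊆ cube d c l ∩ cube d c' l := by
    intro y hy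
    rw [mem_ball] at hy
    have h1 : dist y c ≤ l / 2 := by
      have := dist_triangle y (midpoint ℝ c c') c
      rw [dist_midpoint_left, Real.norm_ofNat, dist_eq_norm c c'] at this
      linarith
    have h2 : dist y c' ≤ l / 2 := by
      have := dist_triangle y (midpoint ℝ c c') c'
      rw [dist_midpoint_right, Real.norm_ofNat, dist_eq_norm c c'] at this
      linarith
    rw [dist_eq_norm] at h1 h2
    exact ⟨fun i => by simpa using (PiLp.norm_apply_le (y - c) i).trans h1,
      fun i => by simpa using (PiLp.norm_apply_le (y - c') i).trans h2⟩
  have hpos : 0 < volume (ball (midpoint ℝ c c') ((l - ‖c - c'‖) / 2)) :=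
    measure_ball_pos _ _ (by linarith)
  exact (hpos.trans_le (measure_mono hsub)).ne' h

/-- A ratio of consecutive radii that makes every generation much finer than the previous one. -/
def scaleRatio (d : ℕ) : ℝ := 8 + (2 * d) ^ d * kappa d + 8 ^ d / kappa d

lemma eight_le_scaleRatio (d : ℕ) : 8 ≤ scaleRatio d := by
  have := kappa_pos d
  unfold scaleRatio
  have h1 : 0 ≤ (2 * d : ℝ) ^ d * kappa d := by positivity
  have h2 : 0 ≤ (8 : ℝ) ^ d / kappa d := by positivity
  linarith

namespace Construction

/-- The side length of the cubes that surround the balls of generation `k + 1`. -/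
def side {B : ℝ} (P : Construction d B) (k : ℕ) : ℝ := sideLength d (P.r (k + 1)) (P.r k)

lemma side_pos {B : ℝ} (P : Construction d B) (k : ℕ) : 0 < P.side k := by
  have := kappa_pos d
  have := P.r_pos k
  have := P.r_pos (k + 1)
  unfold side sideLength
  positivity

lemma side_pow {B : ℝ} (P : Construction d B) (hd : 3 ≤ d) (k : ℕ) :
    P.side k ^ d = kappa d * P.r (k + 1) ^ (d - 2) * P.r k ^ 2 := by
  have := kappa_pos d
  have := P.r_pos k
  have := P.r_pos (k + 1)
  have hd0 : d ≠ 0 := by omega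
  unfold side sideLength
  rw [one_div, Real.rpow_inv_natCast_pow (by positivity) hd0]

lemma deltaSucc_mul {B : ℝ} (P : Construction d B) (hd : 3 ≤ d) (k : ℕ) :
    deltaSucc d P.r k * P.r k = √d * P.side k := by
  have := kappa_pos d
  have h0 := P.r_pos k
  have := P.r_pos (k + 1)
  have hd0 : d ≠ 0 := by omega
  have key : kappa d ^ (1 / (d : ℝ)) * (P.r (k + 1) ^ (d - 2) / P.r k ^ (d - 2)) ^ (1 / (d : ℝ))
      * P.r k = P.side k := by
    have hr : P.r k = (P.r k ^ d) ^ (1 / (d : ℝ)) := by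
      rw [one_div, Real.pow_rpow_inv_natCast h0.le hd0]
    conv_lhs => rw [← Real.mul_rpow (by positivity) (by positivity)]
    conv_lhs => rw [mul_comm]; lhs; rw [hr]
    rw [← Real.mul_rpow (by positivity) (by positivity)]
    unfold side sideLength
    congr 1
    have : P.r k ^ d = P.r k ^ (d - 2) * P.r k ^ 2 := by
      rw [← pow_add]; congr 1; omega
    rw [this]
    field_simp
  rw [← key]
  unfold deltaSucc
  ring

lemma deltaSucc_pos {B : ℝ} (P : Construction d B) (hd : 3 ≤ d) (k : ℕ) :
    0 < deltaSucc d P.r k := by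
  have := kappa_pos d
  have h0 := P.r_pos k
  have := P.r_pos (k + 1)
  have : (0 : ℝ) < d := by exact_mod_cast (by omega : 0 < d)
  unfold deltaSucc
  positivity

lemma r_succ_mul_scaleRatio_lt (P : Construction d (scaleRatio d)) (k : ℕ) :
    P.r (k + 1) * scaleRatio d < P.r k :=
  (lt_div_iff₀ (by linarith [eight_le_scaleRatio d])).1 (P.r_lt k)

lemma eight_mul_r_succ_le (P : Construction d (scaleRatio d)) (k : ℕ) :
    8 * P.r (k + 1) ≤ P.r k := by
  have := P.r_succ_mul_scaleRatio_lt k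
  have := eight_le_scaleRatio d
  nlinarith [P.r_pos (k + 1)]

lemma eight_mul_r_succ_le_side (P : Construction d (scaleRatio d)) (hd : 3 ≤ d) (k : ℕ) :
    8 * P.r (k + 1) ≤ P.side k := by
  have hκ := kappa_pos d
  have h0 := P.r_pos k
  have h1 := P.r_pos (k + 1)
  have hd0 : d ≠ 0 := by omega
  refine le_of_pow_le_pow_left₀ hd0 (P.side_pos k).le ?_
  rw [P.side_pow hd, mul_pow]
  have e : P.r (k + 1) ^ d = P.r (k + 1) ^ (d - 2) * P.r (k + 1) ^ 2 := by
    rw [← pow_add]; congr 1; omega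
  have hB : 8 ^ d ≤ kappa d * scaleRatio d := by
    have : 8 ^ d / kappa d ≤ scaleRatio d := by
      unfold scaleRatio
      have : 0 ≤ (2 * d : ℝ) ^ d * kappa d := by positivity
      linarith
    rw [div_le_iff₀ hκ] at this
    linarith
  have hB1 := eight_le_scaleRatio d
  have hlt := (P.r_succ_mul_scaleRatio_lt k).le
  calc 8 ^ d * P.r (k + 1) ^ d
      ≤ (kappa d * (scaleRatio d * scaleRatio d)) * P.r (k + 1) ^ d := by
        gcongr
        refine hB.trans ?_
        gcongr
        nlinarith
    _ = kappa d * P.r (k + 1) ^ (d - 2) * (P.r (k + 1) * scaleRatio d) ^ 2 := by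
        rw [e]; ring
    _ ≤ _ := by gcongr

lemma deltaSucc_le_half (P : Construction d (scaleRatio d)) (hd : 3 ≤ d) (k : ℕ) :
    deltaSucc d P.r k ≤ 1 / 2 := by
  have hκ := kappa_pos d
  have h0 := P.r_pos k
  have h1 := P.r_pos (k + 1)
  have hd0 : d ≠ 0 := by omega
  have hd1 : (1 : ℝ) ≤ d := by exact_mod_cast (by omega : 1 ≤ d)
  have key : d * P.side k ≤ P.r k / 2 := by
    refine le_of_pow_le_pow_left₀ hd0 (by positivity) ?_
    have e : P.r k ^ d = P.r k ^ (d - 2) * P.r k ^ 2 := by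
      rw [← pow_add]; congr 1; omega
    have e1 : P.r k ^ (d - 2) = P.r k ^ (d - 3) * P.r k := by
      rw [← pow_succ]; congr 1; omega
    have e2 : P.r (k + 1) ^ (d - 2) = P.r (k + 1) ^ (d - 3) * P.r (k + 1) := by
      rw [← pow_succ]; congr 1; omega
    have hle : P.r (k + 1) ≤ P.r k := by linarith [P.eight_mul_r_succ_le k]
    have hB : (2 * d : ℝ) ^ d * kappa d ≤ scaleRatio d := by
      unfold scaleRatio
      have : 0 ≤ (8 : ℝ) ^ d / kappa d := by positivity
      linarith
    have hB0 : 0 < scaleRatio d := by linarith [eight_le_scaleRatio d]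
    rw [mul_pow, P.side_pow hd, div_pow, le_div_iff₀ (by positivity)]
    calc (d : ℝ) ^ d * (kappa d * P.r (k + 1) ^ (d - 2) * P.r k ^ 2) * 2 ^ d
        = ((2 * d) ^ d * kappa d) * P.r (k + 1) * P.r (k + 1) ^ (d - 3) * P.r k ^ 2 := by
          rw [e2, mul_pow]; ring
      _ ≤ scaleRatio d * P.r (k + 1) * P.r k ^ (d - 3) * P.r k ^ 2 := by gcongr
      _ ≤ P.r k * P.r k ^ (d - 3) * P.r k ^ 2 := by
          gcongr
          linarith [P.r_succ_mul_scaleRatio_lt k]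
      _ = P.r k ^ d := by rw [e, e1]; ring
  have hs : √d ≤ d := by
    rw [Real.sqrt_le_left (by positivity)]
    nlinarith
  have hl := P.side_pos k
  have : deltaSucc d P.r k * P.r k ≤ 1 / 2 * P.r k := by
    rw [P.deltaSucc_mul hd]
    nlinarith
  exact le_of_mul_le_mul_right this h0

end Construction

end

/-! ### The kernel: size, Hölder continuity, measurability -/

section

variable {d : ℕ} {Ω : E d → ℝ} {H α : ℝ≥0}

lemma continuous_sphere_of_holder (hα : 0 < α) (hΩ : HolderOnWith H α Ω (sphere (0 : E d) 1)) :
    Continuous fun ξ : sphere (0 : E d) 1 => Ω ξ :=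
  continuousOn_iff_continuous_domRestrict.1 (hΩ.uniformContinuousOn hα).continuousOn

lemma integrable_sphere_of_continuous {f : sphere (0 : E d) 1 → ℝ} (hf : Continuous f) :
    Integrable f (surface d) := by
  have : IsFiniteMeasure (surface d) := by unfold surface; infer_instance
  exact hf.integrable_of_hasCompactSupport (HasCompactSupport.of_compactSpace f)

/-- A Hölder function of mean zero on the sphere is bounded by its oscillation. -/
lemma abs_le_of_holder_of_meanZero (hd : 0 < d) (hα : 0 < α) (hα1 : α ≤ 1)
    (hΩ : HolderOnWith H α Ω (sphere (0 : E d) 1)) (h0 : MeanZero d Ω)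
    {ω : E d} (hω : ω ∈ sphere (0 : E d) 1) : |Ω ω| ≤ 2 * H := by
  have : Nonempty (Fin d) := ⟨⟨0, hd⟩⟩
  have : IsFiniteMeasure (surface d) := by unfold surface; infer_instance
  have hpos : 0 < (surface d).real Set.univ := by
    rw [measureReal_def, ENNReal.toReal_pos_iff]
    refine ⟨?_, measure_lt_top _ _⟩
    rw [Measure.measure_univ_pos]
    exact Measure.toSphere_ne_zero _
  have hint := integrable_sphere_of_continuous (continuous_sphere_of_holder hα hΩ)
  have h1 : ∫ ξ : sphere (0 : E d) 1, (Ω ω - Ω ξ) ∂(surface d)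
      = (surface d).real Set.univ * Ω ω := by
    rw [integral_sub (integrable_const _) hint, h0, integral_const, smul_eq_mul, sub_zero]
  have h2 : ‖∫ ξ : sphere (0 : E d) 1, (Ω ω - Ω ξ) ∂(surface d)‖
      ≤ 2 * H * (surface d).real Set.univ := by
    refine norm_integral_le_of_norm_le_const (Eventually.of_forall fun ξ => ?_)
    have h3 := hΩ.dist_le hω ξ.2
    rw [Real.dist_eq] at h3
    refine h3.trans ?_
    have h4 : dist ω (ξ : E d) ≤ 2 := by
      have e1 : ‖ω‖ = 1 := by simpa using hω
      have e2 : ‖(ξ : E d)‖ = 1 := by simp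
      rw [dist_eq_norm]
      exact (norm_sub_le _ _).trans (by rw [e1, e2]; norm_num)
    have h5 : dist ω (ξ : E d) ^ (α : ℝ) ≤ 2 := by
      calc dist ω (ξ : E d) ^ (α : ℝ) ≤ 2 ^ (α : ℝ) := by gcongr
        _ ≤ 2 ^ (1 : ℝ) := by
          apply Real.rpow_le_rpow_of_exponent_le (by norm_num)
          exact_mod_cast hα1
        _ = 2 := by simp
    have := mul_le_mul_of_nonneg_left h5 H.2
    simp only [NNReal.val_eq_coe] at this
    linarith
  rw [h1, norm_mul, Real.norm_of_nonneg hpos.le, Real.norm_eq_abs, mul_comm] at h2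
  exact le_of_mul_le_mul_right h2 hpos

lemma unit_mem_sphere {x : E d} (hx : x ≠ 0) : ‖x‖⁻¹ • x ∈ sphere (0 : E d) 1 := by
  simp [norm_smul, hx]

lemma dist_unit_le {u v : E d} (hu : u ≠ 0) (hv : v ≠ 0) :
    dist (‖u‖⁻¹ • u) (‖v‖⁻¹ • v) ≤ 2 * (‖u - v‖ / ‖u‖) := by
  have hu' := norm_pos_iff.2 hu
  have hv' := norm_pos_iff.2 hv
  have e : ‖u‖⁻¹ • u - ‖v‖⁻¹ • v = ‖u‖⁻¹ • (u - v) + ((‖v‖ - ‖u‖) / ‖u‖ / ‖v‖) • v := by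
    have : ‖u‖⁻¹ = (‖v‖ - ‖u‖) / ‖u‖ / ‖v‖ + ‖v‖⁻¹ := by field_simp; ring
    rw [smul_sub, sub_add, ← sub_smul]
    congr 2
    linarith
  rw [dist_eq_norm, e]
  refine (norm_add_le _ _).trans ?_
  rw [norm_smul, norm_smul, norm_inv, norm_norm, norm_div, norm_div, norm_norm, norm_norm,
    div_mul_cancel₀ _ hv'.ne']
  have h : ‖‖v‖ - ‖u‖‖ ≤ ‖u - v‖ := by
    rw [norm_sub_rev u v]; exact abs_norm_sub_norm_le v u
  have : ‖‖v‖ - ‖u‖‖ / ‖u‖ ≤ ‖u - v‖ / ‖u‖ := by gcongr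
  rw [inv_mul_eq_div]
  linarith

lemma kernel_zero (hd : 3 ≤ d) : kernel d Ω 0 = 0 := by
  have : d - 2 ≠ 0 := by omega
  simp [kernel, this]

lemma kernel_neg (hΩ : EvenOnSphere d Ω) (x : E d) : kernel d Ω (-x) = kernel d Ω x := by
  rcases eq_or_ne x 0 with rfl | hx
  · simp
  · simp only [kernel, norm_neg, smul_neg]
    rw [hΩ _ (unit_mem_sphere hx)]

lemma abs_kernel_le {M : ℝ} (hd : 3 ≤ d) (hM : ∀ ω ∈ sphere (0 : E d) 1, |Ω ω| ≤ M) (x : E d) :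
    |kernel d Ω x| ≤ M * ‖x‖ ^ (-((d : ℝ) - 2)) := by
  have hd2 : (0 : ℝ) < (d : ℝ) - 2 := by
    have : (3 : ℝ) ≤ d := by exact_mod_cast hd
    linarith
  rcases eq_or_ne x 0 with rfl | hx
  · rw [kernel_zero hd, norm_zero, Real.zero_rpow (by linarith)]; simp
  · have hx' := norm_pos_iff.2 hx
    rw [Real.rpow_neg hx'.le, show ((d : ℝ) - 2) = ((d - 2 : ℕ) : ℝ) by
      rw [Nat.cast_sub (by omega)]; simp, Real.rpow_natCast, kernel, abs_div, abs_pow, abs_norm,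
      div_eq_mul_inv]
    gcongr
    exact hM _ (unit_mem_sphere hx)

lemma inv_pow_sub_inv_pow_le {a b : ℝ} (n : ℕ) (hb : 0 < b) (hab : b ≤ a) :
    (b ^ n)⁻¹ - (a ^ n)⁻¹ ≤ n * ((a - b) / a) * (b ^ n)⁻¹ := by
  have ha : 0 < a := hb.trans_le hab
  have h := one_add_mul_le_pow (a := b / a - 1) (by have : 0 < b / a := by positivity
                                                    linarith) n
  rw [add_sub_cancel, div_pow] at h
  have e : (a - b) / a = 1 - b / a := by field_simp
  rw [e]
  have e2 : (a ^ n)⁻¹ = b ^ n / a ^ n * (b ^ n)⁻¹ := by field_simp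
  rw [e2]
  have hp : 0 < (b ^ n)⁻¹ := by positivity
  nlinarith

lemma abs_kernel_sub_le_of_norm_le {M : ℝ} (hd : 3 ≤ d) (hα : 0 < α) (hα1 : α ≤ 1)
    (hΩ : HolderOnWith H α Ω (sphere (0 : E d) 1))
    (hM : ∀ ω ∈ sphere (0 : E d) 1, |Ω ω| ≤ M) {u v : E d} (hv : v ≠ 0) (huv : ‖v‖ ≤ ‖u‖) :
    |kernel d Ω u - kernel d Ω v| ≤
      (2 * H + d * M) * (‖u - v‖ ^ (α : ℝ) * ‖v‖ ^ (-((d : ℝ) - 2 + α))) := by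
  have hb := norm_pos_iff.2 hv
  have ha : 0 < ‖u‖ := hb.trans_le huv
  have hu : u ≠ 0 := norm_pos_iff.1 ha
  have hM0 : 0 ≤ M := (abs_nonneg _).trans (hM _ (unit_mem_sphere hv))
  have hα1' : (α : ℝ) ≤ 1 := by exact_mod_cast hα1
  have hα' : (0 : ℝ) < α := by exact_mod_cast hα
  set n := d - 2 with hn
  have hnd : ((d : ℝ) - 2) = (n : ℝ) := by rw [hn, Nat.cast_sub (by omega)]; simp
  have hnd' : (n : ℝ) ≤ d := by rw [← hnd]; linarith
  have hw : ‖v‖ ^ (-((d : ℝ) - 2 + α)) = (‖v‖ ^ n)⁻¹ * (‖v‖ ^ (α : ℝ))⁻¹ := by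
    rw [Real.rpow_neg hb.le, hnd, Real.rpow_add hb, Real.rpow_natCast, mul_inv]
  have e : kernel d Ω u - kernel d Ω v =
      (Ω (‖u‖⁻¹ • u) - Ω (‖v‖⁻¹ • v)) * (‖u‖ ^ n)⁻¹
        - Ω (‖v‖⁻¹ • v) * ((‖v‖ ^ n)⁻¹ - (‖u‖ ^ n)⁻¹) := by
    simp only [kernel]; ring
  have h1 : |(Ω (‖u‖⁻¹ • u) - Ω (‖v‖⁻¹ • v)) * (‖u‖ ^ n)⁻¹| ≤
      2 * H * (‖u - v‖ ^ (α : ℝ) * ((‖v‖ ^ n)⁻¹ * (‖v‖ ^ (α : ℝ))⁻¹)) := by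
    rw [abs_mul, abs_of_pos (by positivity : 0 < (‖u‖ ^ n)⁻¹)]
    have h3 := hΩ.dist_le (unit_mem_sphere hu) (unit_mem_sphere hv)
    rw [Real.dist_eq] at h3
    have h4 : dist (‖u‖⁻¹ • u) (‖v‖⁻¹ • v) ^ (α : ℝ) ≤
        2 * (‖u - v‖ ^ (α : ℝ) * (‖v‖ ^ (α : ℝ))⁻¹) := by
      calc dist (‖u‖⁻¹ • u) (‖v‖⁻¹ • v) ^ (α : ℝ)
          ≤ (2 * (‖u - v‖ / ‖u‖)) ^ (α : ℝ) := by
            gcongr; exact dist_unit_le hu hv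
        _ = 2 ^ (α : ℝ) * (‖u - v‖ ^ (α : ℝ) * (‖u‖ ^ (α : ℝ))⁻¹) := by
            rw [Real.mul_rpow (by norm_num) (by positivity), Real.div_rpow (by positivity) ha.le,
              div_eq_mul_inv]
        _ ≤ 2 * (‖u - v‖ ^ (α : ℝ) * (‖v‖ ^ (α : ℝ))⁻¹) := by
            gcongr
            calc (2 : ℝ) ^ (α : ℝ) ≤ 2 ^ (1 : ℝ) :=
                  Real.rpow_le_rpow_of_exponent_le (by norm_num) hα1'
              _ = 2 := by simp
    calc _ ≤ (H * (2 * (‖u - v‖ ^ (α : ℝ) * (‖v‖ ^ (α : ℝ))⁻¹))) * (‖v‖ ^ n)⁻¹ := by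
          gcongr
          exact h3.trans (by gcongr)
      _ = _ := by ring
  have h2 : |Ω (‖v‖⁻¹ • v) * ((‖v‖ ^ n)⁻¹ - (‖u‖ ^ n)⁻¹)| ≤
      d * M * (‖u - v‖ ^ (α : ℝ) * ((‖v‖ ^ n)⁻¹ * (‖v‖ ^ (α : ℝ))⁻¹)) := by
    have hnn : 0 ≤ (‖v‖ ^ n)⁻¹ - (‖u‖ ^ n)⁻¹ := sub_nonneg.2 (by gcongr)
    rw [abs_mul, abs_of_nonneg hnn]
    have h3 := inv_pow_sub_inv_pow_le n hb huv
    set t := (‖u‖ - ‖v‖) / ‖u‖ with ht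
    have ht0 : 0 ≤ t := div_nonneg (sub_nonneg.2 huv) ha.le
    have ht1 : t ≤ 1 := by rw [ht, div_le_one ha]; linarith
    have ht2 : t ≤ ‖u - v‖ / ‖v‖ := by
      rw [ht]; gcongr; exact norm_sub_norm_le u v
    have h4 : t ≤ ‖u - v‖ ^ (α : ℝ) * (‖v‖ ^ (α : ℝ))⁻¹ := by
      calc t = t ^ (1 : ℝ) := by simp
        _ ≤ t ^ (α : ℝ) := by
          rcases ht0.eq_or_lt with h | h
          · rw [← h, Real.zero_rpow (by norm_num), Real.zero_rpow hα'.ne']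
          · exact Real.rpow_le_rpow_of_exponent_ge h ht1 hα1'
        _ ≤ (‖u - v‖ / ‖v‖) ^ (α : ℝ) := by gcongr
        _ = _ := by rw [Real.div_rpow (by positivity) hb.le, div_eq_mul_inv]
    calc _ ≤ M * (d * (‖u - v‖ ^ (α : ℝ) * (‖v‖ ^ (α : ℝ))⁻¹) * (‖v‖ ^ n)⁻¹) := by
          gcongr
          · exact hM _ (unit_mem_sphere hv)
          · exact h3.trans (by gcongr)
      _ = _ := by ring
  rw [e, hw]
  refine (abs_sub _ _).trans ?_
  linarith

/-- The Hölder estimate for the kernel. It also holds when `u` or `v` is the origin, since there the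
kernel and the negative powers of the norm vanish by convention. -/
lemma abs_kernel_sub_le {M : ℝ} (hd : 3 ≤ d) (hα : 0 < α) (hα1 : α ≤ 1)
    (hΩ : HolderOnWith H α Ω (sphere (0 : E d) 1))
    (hM : ∀ ω ∈ sphere (0 : E d) 1, |Ω ω| ≤ M) (u v : E d) :
    |kernel d Ω u - kernel d Ω v| ≤ (2 * H + d * M) * (‖u - v‖ ^ (α : ℝ) *
      (‖u‖ ^ (-((d : ℝ) - 2 + α)) + ‖v‖ ^ (-((d : ℝ) - 2 + α)))) := by
  have hd2 : (3 : ℝ) ≤ d := by exact_mod_cast hd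
  have hM0 : 0 ≤ M := by
    obtain ⟨w, hw⟩ : ∃ w : E d, w ≠ 0 := by
      have : Nonempty (Fin d) := ⟨⟨0, by omega⟩⟩
      exact exists_ne 0
    exact (abs_nonneg _).trans (hM _ (unit_mem_sphere hw))
  wlog huv : ‖v‖ ≤ ‖u‖ generalizing u v with h
  · have := h v u (le_of_not_ge huv)
    rwa [abs_sub_comm, norm_sub_rev, add_comm (‖v‖ ^ _)] at this
  rcases eq_or_ne v 0 with rfl | hv
  · rcases eq_or_ne u 0 with rfl | hu
    · simp only [sub_self, abs_zero]; positivity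
    have hu' := norm_pos_iff.2 hu
    rw [kernel_zero hd, sub_zero, sub_zero]
    refine (abs_kernel_le hd hM u).trans ?_
    have e : ‖u‖ ^ (-((d : ℝ) - 2)) = ‖u‖ ^ (α : ℝ) * ‖u‖ ^ (-((d : ℝ) - 2 + α)) := by
      rw [← Real.rpow_add hu']; congr 1; ring
    rw [e]
    have : M ≤ 2 * H + d * M := by nlinarith [H.2]
    gcongr
    have : 0 ≤ ‖(0 : E d)‖ ^ (-((d : ℝ) - 2 + α)) := by positivity
    linarith
  · refine (abs_kernel_sub_le_of_norm_le hd hα hα1 hΩ hM hv huv).trans ?_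
    gcongr
    have : 0 ≤ ‖u‖ ^ (-((d : ℝ) - 2 + α)) := by positivity
    linarith

lemma continuousOn_kernel (hα : 0 < α) (hΩ : HolderOnWith H α Ω (sphere (0 : E d) 1)) :
    ContinuousOn (kernel d Ω) {0}ᶜ := by
  have hcont : ContinuousOn Ω (sphere (0 : E d) 1) := (hΩ.uniformContinuousOn hα).continuousOn
  have h1 : ContinuousOn (fun x : E d => ‖x‖⁻¹ • x) {0}ᶜ :=
    (continuousOn_id.norm.inv₀ fun x hx => norm_ne_zero_iff.2 hx).smul continuousOn_id
  exact (hcont.comp h1 fun x hx => unit_mem_sphere hx).div (by fun_prop)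
    fun x hx => pow_ne_zero _ (norm_ne_zero_iff.2 hx)

lemma measurable_kernel (hα : 0 < α) (hΩ : HolderOnWith H α Ω (sphere (0 : E d) 1)) :
    Measurable (kernel d Ω) :=
  measurable_of_continuousOn_compl_singleton 0 (continuousOn_kernel hα hΩ)

end

/-! ### Riesz potentials of sets of given volume -/

section

variable {d : ℕ}

lemma integrableOn_ball_norm_rpow {s : ℝ} (hd : 0 < d) (hs : s ≤ d - 1) {t : ℝ} (ht : 0 < t) :
    IntegrableOn (fun y : E d => ‖y‖ ^ (-s)) (ball 0 t) := by
  have : Nonempty (Fin d) := ⟨⟨0, hd⟩⟩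
  rw [integrableOn_fun_norm_addHaar volume (f := fun y : ℝ => y ^ (-s))]
  simp only [finrank_euclideanSpace, Fintype.card_fin, smul_eq_mul]
  have h : IntegrableOn (fun y : ℝ => y ^ ((d : ℝ) - 1 - s)) (Set.Ioo 0 t) := by
    rw [intervalIntegral.integrableOn_Ioo_rpow_iff ht]
    linarith
  refine h.congr_fun (fun y hy => ?_) measurableSet_Ioo
  simp only
  rw [← Real.rpow_natCast, ← Real.rpow_add hy.1, Nat.cast_sub hd]
  congr 1
  push_cast
  ring

lemma integral_ball_norm_rpow {s t : ℝ} (hd : 0 < d) (hs : s ≤ d - 1) (ht : 0 < t) :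
    ∫ y in ball (0 : E d) t, ‖y‖ ^ (-s) ≤ d * kappa d * t ^ (d - s) := by
  have : Nonempty (Fin d) := ⟨⟨0, hd⟩⟩
  have hκ := kappa_pos d
  have e : ∫ y in ball (0 : E d) t, ‖y‖ ^ (-s) =
      ∫ y : E d, (Set.Iio t).indicator (fun a : ℝ => a ^ (-s)) ‖y‖ := by
    rw [← integral_indicator measurableSet_ball]
    congr 1
    ext y
    simp [Set.indicator]
  have hball : volume.real (ball (0 : E d) 1) = kappa d := by
    rw [measureReal_def, ← Measure.addHaar_closedBall_eq_addHaar_ball,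
      volume_closedBall_eq hd _ zero_le_one]
    simp [hκ.le]
  have e2 : ∫ y in Set.Ioi (0 : ℝ), y ^ (d - 1) • (Set.Iio t).indicator (fun a : ℝ => a ^ (-s)) y
      = t ^ (d - s) / (d - s) := by
    have : ∀ y ∈ Set.Ioi (0 : ℝ), y ^ (d - 1) • (Set.Iio t).indicator (fun a : ℝ => a ^ (-s)) y
        = (Set.Iio t).indicator (fun a : ℝ => a ^ ((d : ℝ) - 1 - s)) y := by
      intro y hy
      by_cases h : y < t
      · simp only [Set.indicator, Set.mem_Iio, h, if_true, smul_eq_mul]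
        rw [← Real.rpow_natCast, ← Real.rpow_add hy, Nat.cast_sub hd]
        congr 1
        push_cast
        ring
      · simp [h]
    rw [setIntegral_congr_fun measurableSet_Ioi this, setIntegral_indicator measurableSet_Iio,
      Set.Ioi_inter_Iio, ← integral_Ioc_eq_integral_Ioo, ← intervalIntegral.integral_of_le ht.le,
      integral_rpow (Or.inl (by linarith)), Real.zero_rpow (by linarith)]
    ring_nf
  rw [e, integral_fun_norm_addHaar volume, finrank_euclideanSpace, Fintype.card_fin, e2, hball,
    nsmul_eq_mul, smul_eq_mul, ← mul_assoc]
  have h1 : (1 : ℝ) ≤ d - s := by linarith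
  gcongr
  exact div_le_self (by positivity) h1

/-- The Riesz potential of a set is controlled by the volume of the set. -/
lemma integral_norm_rpow_le {s t : ℝ} (hd : 0 < d) (hs0 : 0 ≤ s) (hs : s ≤ d - 1) (ht : 0 < t)
    {A : Set (E d)} (hvol : volume A ≤ ENNReal.ofReal (t ^ d)) (x : E d) :
    IntegrableOn (fun ζ => ‖x - ζ‖ ^ (-s)) A ∧
      ∫ ζ in A, ‖x - ζ‖ ^ (-s) ≤ (d * kappa d + 1) * t ^ (d - s) := by
  set g : E d → ℝ := (ball x t).indicator fun ζ => ‖x - ζ‖ ^ (-s) with hg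
  have eg : g = fun ζ => (ball (0 : E d) t).indicator (fun y => ‖y‖ ^ (-s)) (x - ζ) := by
    ext ζ
    have : ζ ∈ ball x t ↔ x - ζ ∈ ball (0 : E d) t := by
      rw [mem_ball, mem_ball_zero_iff, dist_eq_norm, norm_sub_rev]
    by_cases h : ζ ∈ ball x t
    · rw [hg, Set.indicator_of_mem h, Set.indicator_of_mem (this.1 h)]
    · rw [hg, Set.indicator_of_notMem h, Set.indicator_of_notMem (fun h' => h (this.2 h'))]
  have hgi : Integrable g := by
    rw [eg]
    exact ((integrable_indicator_iff measurableSet_ball).2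
      (integrableOn_ball_norm_rpow hd hs ht)).comp_sub_left x
  have hgint : ∫ ζ, g ζ ≤ d * kappa d * t ^ (d - s) := by
    rw [eg,
      integral_sub_left_eq_self (fun y => (ball (0 : E d) t).indicator (fun y => ‖y‖ ^ (-s)) y),
      integral_indicator measurableSet_ball]
    exact integral_ball_norm_rpow hd hs ht
  have hg0 : ∀ ζ, 0 ≤ g ζ := fun ζ => Set.indicator_nonneg (fun _ _ => by positivity) ζ
  have hfin : volume A ≠ ⊤ := (hvol.trans_lt ENNReal.ofReal_lt_top).ne
  have hc : IntegrableOn (fun _ : E d => t ^ (-s)) A := integrableOn_const hfin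
  have hle : ∀ ζ, ‖x - ζ‖ ^ (-s) ≤ g ζ + t ^ (-s) := by
    intro ζ
    by_cases h : ζ ∈ ball x t
    · rw [hg, Set.indicator_of_mem h]
      have : 0 ≤ t ^ (-s) := by positivity
      linarith
    · rw [hg, Set.indicator_of_notMem h, zero_add]
      rw [mem_ball, dist_eq_norm, norm_sub_rev, not_lt] at h
      exact Real.rpow_le_rpow_of_nonpos ht h (by linarith)
  have hsum : IntegrableOn (fun ζ => g ζ + t ^ (-s)) A := hgi.integrableOn.add hc
  have hi : IntegrableOn (fun ζ => ‖x - ζ‖ ^ (-s)) A := by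
    refine hsum.mono' ?_ (Eventually.of_forall fun ζ => ?_)
    · exact ((measurable_const.sub measurable_id).norm.pow_const _).aestronglyMeasurable
    · rw [Real.norm_of_nonneg (by positivity)]; exact hle ζ
  refine ⟨hi, ?_⟩
  calc ∫ ζ in A, ‖x - ζ‖ ^ (-s) ≤ ∫ ζ in A, (g ζ + t ^ (-s)) :=
        setIntegral_mono hi hsum hle
    _ = (∫ ζ in A, g ζ) + volume.real A * t ^ (-s) := by
        rw [integral_add hgi.integrableOn hc, setIntegral_const, smul_eq_mul]
    _ ≤ d * kappa d * t ^ (d - s) + t ^ d * t ^ (-s) := by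
        gcongr
        · exact (setIntegral_le_integral hgi (Eventually.of_forall hg0)).trans hgint
        · exact ENNReal.toReal_le_of_le_ofReal (by positivity) hvol
    _ = (d * kappa d + 1) * t ^ (d - s) := by
        rw [← Real.rpow_natCast, ← Real.rpow_add ht, add_mul, one_mul, sub_eq_add_neg]

end

/-! ### The potential of a ball vanishes inside the ball -/

section

variable {d : ℕ} {Ω : E d → ℝ} {H α : ℝ≥0}

lemma integrableOn_kernel {M : ℝ} (hd : 3 ≤ d) (hα : 0 < α)
    (hΩ : HolderOnWith H α Ω (sphere (0 : E d) 1))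
    (hM : ∀ ω ∈ sphere (0 : E d) 1, |Ω ω| ≤ M) (x : E d) {A : Set (E d)} (hA : volume A ≠ ⊤) :
    IntegrableOn (fun ζ => kernel d Ω (x - ζ)) A := by
  have hd3 : (3 : ℝ) ≤ d := by exact_mod_cast hd
  obtain ⟨t, ht, hvol⟩ : ∃ t : ℝ, 0 < t ∧ volume A ≤ ENNReal.ofReal (t ^ d) := by
    refine ⟨(volume A).toReal + 1, by positivity, ?_⟩
    rw [← ENNReal.ofReal_toReal hA]
    refine ENNReal.ofReal_le_ofReal ?_
    rw [ENNReal.toReal_ofReal ENNReal.toReal_nonneg]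
    have h0 : 0 ≤ (volume A).toReal := ENNReal.toReal_nonneg
    have := le_self_pow₀ (a := (volume A).toReal + 1) (by linarith) (by omega : d ≠ 0)
    linarith
  have h := (integral_norm_rpow_le (s := (d : ℝ) - 2) (by omega) (by linarith) (by linarith) ht
    hvol x).1
  refine (h.const_mul M).mono' ?_ (Eventually.of_forall fun ζ => ?_)
  · exact ((measurable_kernel hα hΩ).comp (measurable_const.sub measurable_id)).aestronglyMeasurable
  · rw [Real.norm_eq_abs]; exact abs_kernel_le hd hM _

lemma integral_polar {f : E d → ℝ} (hd : 0 < d) (hf : Integrable f) :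
    ∫ y, f y = ∫ ω : sphere (0 : E d) 1,
      (∫ t in Set.Ioi (0 : ℝ), t ^ (d - 1) * f (t • (ω : E d))) ∂(surface d) := by
  have : Nonempty (Fin d) := ⟨⟨0, hd⟩⟩
  have hmp := (volume : Measure (E d)).measurePreserving_homeomorphUnitSphereProd
  have hemb := (homeomorphUnitSphereProd (E d)).measurableEmbedding
  have hfe : ∀ y : ({0}ᶜ : Set (E d)), f y =
      (fun p : sphere (0 : E d) 1 × Set.Ioi (0 : ℝ) => f ((p.2 : ℝ) • (p.1 : E d)))
        (homeomorphUnitSphereProd (E d) y) := by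
    intro y
    have hy : ‖(y : E d)‖ ≠ 0 := norm_ne_zero_iff.2 y.2
    simp [smul_smul, hy]
  have hint : Integrable (fun p : sphere (0 : E d) 1 × Set.Ioi (0 : ℝ) =>
      f ((p.2 : ℝ) • (p.1 : E d)))
      ((volume : Measure (E d)).toSphere.prod
        (Measure.volumeIoiPow (Module.finrank ℝ (E d) - 1))) := by
    rw [← hmp.integrable_comp_emb hemb]
    have h1 : IntegrableOn f {0}ᶜ := hf.integrableOn
    rw [integrableOn_iff_comap_subtypeVal (measurableSet_singleton _).compl] at h1
    exact h1.congr (Eventually.of_forall hfe)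
  calc ∫ y, f y = ∫ y : ({0}ᶜ : Set (E d)), f y
        ∂((volume : Measure (E d)).comap Subtype.val) := by
        rw [integral_subtype_comap (measurableSet_singleton _).compl f,
          restrict_compl_singleton]
    _ = ∫ p, (fun p : sphere (0 : E d) 1 × Set.Ioi (0 : ℝ) => f ((p.2 : ℝ) • (p.1 : E d))) p
          ∂((volume : Measure (E d)).toSphere.prod
            (Measure.volumeIoiPow (Module.finrank ℝ (E d) - 1))) := by
        rw [← hmp.integral_comp hemb]
        exact integral_congr_ae (Eventually.of_forall hfe)
    _ = _ := by
        rw [integral_prod _ hint, surface]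
        congr 1
        ext ω
        simp only [Measure.volumeIoiPow, ENNReal.ofReal]
        rw [integral_withDensity_eq_integral_smul (by fun_prop),
          integral_subtype_comap measurableSet_Ioi
            (fun t => Real.toNNReal (t ^ (Module.finrank ℝ (E d) - 1)) • f (t • (ω : E d))),
          finrank_euclideanSpace, Fintype.card_fin]
        refine setIntegral_congr_fun measurableSet_Ioi fun t ht => ?_
        simp only [NNReal.smul_def, smul_eq_mul]
        rw [Real.coe_toNNReal _ (pow_nonneg (le_of_lt ht) _)]

/-- The length of the ray from the origin in the direction `ω` inside a ball that contains the
origin. -/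
lemma norm_smul_sub_le_iff {a ω : E d} {R t : ℝ} (hω : ‖ω‖ = 1) (ha : ‖a‖ ≤ R) (ht : 0 < t) :
    ‖t • ω - a‖ ≤ R ↔ t ≤ inner ℝ ω a + √(inner ℝ ω a ^ 2 + (R ^ 2 - ‖a‖ ^ 2)) := by
  set p := inner ℝ ω a
  have hR : 0 ≤ R := (norm_nonneg a).trans ha
  have hq : 0 ≤ R ^ 2 - ‖a‖ ^ 2 := by nlinarith [norm_nonneg a]
  have e : ‖t • ω - a‖ ^ 2 = (t - p) ^ 2 - p ^ 2 + ‖a‖ ^ 2 := by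
    rw [norm_sub_sq_real, norm_smul, hω, inner_smul_left, Real.norm_of_nonneg ht.le]
    simp only [conj_trivial]
    ring
  have hp : |p| ≤ √(p ^ 2 + (R ^ 2 - ‖a‖ ^ 2)) := Real.abs_le_sqrt (by linarith)
  have hs : √(p ^ 2 + (R ^ 2 - ‖a‖ ^ 2)) ^ 2 = p ^ 2 + (R ^ 2 - ‖a‖ ^ 2) :=
    Real.sq_sqrt (by positivity)
  rw [← sq_le_sq₀ (norm_nonneg _) hR, e]
  set S := √(p ^ 2 + (R ^ 2 - ‖a‖ ^ 2))
  have h1 := abs_le.1 hp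
  constructor
  · intro h
    have : |t - p| ≤ S := by
      apply abs_le_of_sq_le_sq _ (Real.sqrt_nonneg _)
      linarith
    linarith [(abs_le.1 this).2]
  · intro h
    have : (t - p) ^ 2 ≤ S ^ 2 := by
      apply sq_le_sq'
      · linarith
      · linarith
    linarith

lemma integral_ray {p : ℝ} (hp : 0 ≤ p) :
    ∫ t in Set.Ioi (0 : ℝ), (Set.Iic p).indicator (fun t => t) t = p ^ 2 / 2 := by
  rw [setIntegral_indicator measurableSet_Iic, Set.Ioi_inter_Iic,
    ← intervalIntegral.integral_of_le hp, integral_id]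
  ring

/-- **The potential of a ball vanishes inside the ball.** In polar coordinates about the point, the
rays in the directions `ω` and `-ω` together contribute a quadratic polynomial in `ω`, to which the
kernel is orthogonal. -/
theorem integral_closedBall_kernel_eq_zero (hd : 3 ≤ d) (hα : 0 < α) (hα1 : α ≤ 1)
    (heven : EvenOnSphere d Ω) (hΩ : HolderOnWith H α Ω (sphere (0 : E d) 1))
    (h0 : MeanZero d Ω) (h2 : MomentCondition d Ω) {x z : E d} {R : ℝ} (hx : ‖x - z‖ ≤ R) :
    ∫ ζ in closedBall z R, kernel d Ω (x - ζ) = 0 := by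
  have hM : ∀ ω ∈ sphere (0 : E d) 1, |Ω ω| ≤ 2 * H :=
    fun ω hω => abs_le_of_holder_of_meanZero (by omega) hα hα1 hΩ h0 hω
  set a := x - z with ha
  have hR : 0 ≤ R := (norm_nonneg a).trans hx
  -- The kernel, cut off to the ball about `b`.
  let F : E d → E d → ℝ := fun b => (closedBall b R).indicator (kernel d Ω)
  have hFi : ∀ b, Integrable (F b) := fun b => by
    rw [integrable_indicator_iff measurableSet_closedBall]
    have h := integrableOn_kernel hd hα hΩ hM 0 (A := closedBall b R)
      measure_closedBall_lt_top.ne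
    refine h.congr_fun (fun ζ _ => ?_) measurableSet_closedBall
    simp only [zero_sub]
    exact kernel_neg heven ζ
  have e1 : ∫ ζ in closedBall z R, kernel d Ω (x - ζ) = ∫ y, F a y := by
    rw [← integral_indicator measurableSet_closedBall, ← integral_sub_left_eq_self (F a) volume x]
    congr 1
    ext ζ
    have hiff : ζ ∈ closedBall z R ↔ x - ζ ∈ closedBall a R := by
      rw [mem_closedBall, mem_closedBall, dist_eq_norm, dist_eq_norm, ha, sub_sub_sub_cancel_left,
        norm_sub_rev]
    by_cases h : ζ ∈ closedBall z R
    · simp only [F, Set.indicator_of_mem h, Set.indicator_of_mem (hiff.1 h)]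
    · simp only [F, Set.indicator_of_notMem h, Set.indicator_of_notMem (fun h' => h (hiff.2 h'))]
  have e2 : ∫ y, F (-a) y = ∫ y, F a y := by
    rw [← integral_neg_eq_self (F a)]
    congr 1
    ext y
    have hiff : y ∈ closedBall (-a) R ↔ -y ∈ closedBall a R := by
      rw [mem_closedBall, mem_closedBall, dist_eq_norm, dist_eq_norm, ← norm_neg]
      congr! 2
      abel
    by_cases h : y ∈ closedBall (-a) R
    · simp only [F, Set.indicator_of_mem h, Set.indicator_of_mem (hiff.1 h), kernel_neg heven]
    · simp only [F, Set.indicator_of_notMem h, Set.indicator_of_notMem (fun h' => h (hiff.2 h'))]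
  have hq : 0 ≤ R ^ 2 - ‖a‖ ^ 2 := by nlinarith [norm_nonneg a]
  -- The contribution of one ray.
  have ray : ∀ b : E d, ‖b‖ = ‖a‖ → ∀ ω : sphere (0 : E d) 1,
      ∀ t ∈ Set.Ioi (0 : ℝ), t ^ (d - 1) * F b (t • (ω : E d)) = Ω ω *
        (Set.Iic (inner ℝ (ω : E d) b + √(inner ℝ (ω : E d) b ^ 2 + (R ^ 2 - ‖a‖ ^ 2)))).indicator
          (fun t => t) t := by
    intro b hb ω t ht
    have ht' : 0 < t := ht
    have hω : ‖(ω : E d)‖ = 1 := by simp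
    have hiff := norm_smul_sub_le_iff (a := b) hω (hb.trans_le hx) ht'
    rw [hb] at hiff
    have hn : ‖t • (ω : E d)‖ = t := by rw [norm_smul, hω, mul_one, Real.norm_of_nonneg ht'.le]
    have hk : t ^ (d - 1) * kernel d Ω (t • (ω : E d)) = Ω ω * t := by
      have : t ^ (d - 1) = t ^ (d - 2) * t := by rw [← pow_succ]; congr 1; omega
      rw [kernel, hn, smul_smul, inv_mul_cancel₀ ht'.ne', one_smul, this]
      field_simp
    by_cases h : ‖t • (ω : E d) - b‖ ≤ R
    · have h' : t • (ω : E d) ∈ closedBall b R := by rwa [mem_closedBall, dist_eq_norm]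
      simp only [F]
      rw [Set.indicator_of_mem h', Set.indicator_of_mem (Set.mem_Iic.2 (hiff.1 h)), hk]
    · have h' : t • (ω : E d) ∉ closedBall b R := by rwa [mem_closedBall, dist_eq_norm]
      simp only [F]
      rw [Set.indicator_of_notMem h', mul_zero,
        Set.indicator_of_notMem (fun h'' => h (hiff.2 (Set.mem_Iic.1 h''))), mul_zero]
  have pot : ∀ b : E d, ‖b‖ = ‖a‖ → ∫ y, F b y = ∫ ω : sphere (0 : E d) 1, Ω ω *
      ((inner ℝ (ω : E d) b + √(inner ℝ (ω : E d) b ^ 2 + (R ^ 2 - ‖a‖ ^ 2))) ^ 2 / 2)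
        ∂(surface d) := by
    intro b hb
    rw [integral_polar (by omega) (hFi b)]
    congr 1
    ext ω
    rw [setIntegral_congr_fun measurableSet_Ioi (ray b hb ω), integral_const_mul, integral_ray]
    have := Real.abs_le_sqrt (x := inner ℝ (ω : E d) b)
      (y := inner ℝ (ω : E d) b ^ 2 + (R ^ 2 - ‖a‖ ^ 2)) (by linarith)
    linarith [(abs_le.1 this).1]
  have hΩc := continuous_sphere_of_holder hα hΩ
  have hci : ∀ b : E d, Integrable (fun ω : sphere (0 : E d) 1 => Ω ω *
      ((inner ℝ (ω : E d) b + √(inner ℝ (ω : E d) b ^ 2 + (R ^ 2 - ‖a‖ ^ 2))) ^ 2 / 2))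
        (surface d) := fun b =>
    integrable_sphere_of_continuous (hΩc.mul (by fun_prop))
  have hii : ∀ i j : Fin d, Integrable (fun ω : sphere (0 : E d) 1 =>
      2 * (a i * a j) * ((ω : E d) i * (ω : E d) j * Ω ω)) (surface d) := fun i j =>
    integrable_sphere_of_continuous (continuous_const.mul (Continuous.mul (by fun_prop) hΩc))
  have key : (∫ y, F a y) + ∫ y, F (-a) y = 0 := by
    rw [pot a rfl, pot (-a) (norm_neg a), ← integral_add (hci a) (hci (-a))]
    have e3 : ∀ ω : sphere (0 : E d) 1, Ω ω *
        ((inner ℝ (ω : E d) a + √(inner ℝ (ω : E d) a ^ 2 + (R ^ 2 - ‖a‖ ^ 2))) ^ 2 / 2) +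
        Ω ω * ((inner ℝ (ω : E d) (-a) + √(inner ℝ (ω : E d) (-a) ^ 2 + (R ^ 2 - ‖a‖ ^ 2))) ^ 2 / 2)
        = (∑ i, ∑ j, 2 * (a i * a j) * ((ω : E d) i * (ω : E d) j * Ω ω))
          + (R ^ 2 - ‖a‖ ^ 2) * Ω ω := by
      intro ω
      have hs : √(inner ℝ (ω : E d) a ^ 2 + (R ^ 2 - ‖a‖ ^ 2)) ^ 2
          = inner ℝ (ω : E d) a ^ 2 + (R ^ 2 - ‖a‖ ^ 2) := Real.sq_sqrt (by positivity)
      have hsum : ∑ i, ∑ j, 2 * (a i * a j) * ((ω : E d) i * (ω : E d) j * Ω ω)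
          = 2 * inner ℝ (ω : E d) a ^ 2 * Ω ω := by
        have : inner ℝ (ω : E d) a = ∑ i, a i * (ω : E d) i := by
          rw [PiLp.inner_apply]
          simp
        rw [this, sq, Finset.sum_mul_sum, Finset.mul_sum, Finset.sum_mul]
        refine Finset.sum_congr rfl fun i _ => ?_
        rw [Finset.mul_sum, Finset.sum_mul]
        refine Finset.sum_congr rfl fun j _ => ?_
        ring
      rw [hsum, inner_neg_right, neg_sq]
      linear_combination (Ω ω) * hs
    simp_rw [e3]
    have hB : Integrable (fun ω : sphere (0 : E d) 1 => (R ^ 2 - ‖a‖ ^ 2) * Ω ω) (surface d) :=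
      integrable_sphere_of_continuous (continuous_const.mul hΩc)
    rw [integral_add
      (integrable_finsetSum _ fun i _ => integrable_finsetSum _ fun j _ => hii i j) hB,
      integral_finsetSum _ fun i _ => integrable_finsetSum _ fun j _ => hii i j,
      integral_const_mul, h0, mul_zero, add_zero]
    refine Finset.sum_eq_zero fun i _ => ?_
    rw [integral_finsetSum _ fun j _ => hii i j]
    refine Finset.sum_eq_zero fun j _ => ?_
    rw [integral_const_mul, h2 i j, mul_zero]
  rw [e1]
  linarith [e2 ▸ key]

end

/-! ### The tree of balls and the measures it carries -/

section

variable {d : ℕ}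

namespace Construction

section Tree

variable {B : ℝ} (P : Construction d B)

lemma mem_centers_succ {k : ℕ} {c : E d} :
    c ∈ P.centers (k + 1) ↔ ∃ z ∈ P.centers k, c ∈ P.children k z := by
  simp [centers, centersOf]

lemma norm_child_sub_le {k : ℕ} {z c : E d} (hz : z ∈ P.centers k) (hc : c ∈ P.children k z) :
    ‖c - z‖ ≤ (1 + deltaSucc d P.r k) * P.r k := by
  have := P.cube_subset k z hz c hc (center_mem_cube c (P.side_pos k).le)
  rwa [mem_closedBall, dist_eq_norm] at this

lemma side_le_norm_sub {k : ℕ} {z c c' : E d} (hz : z ∈ P.centers k) (hc : c ∈ P.children k z)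
    (hc' : c' ∈ P.children k z) (hne : c ≠ c') : P.side k ≤ ‖c - c'‖ :=
  le_norm_sub_of_aedisjoint_cube (P.disjoint_cubes k z hz c hc c' hc' hne)

/-- The measure that the construction puts, `n` generations later, on the descendants of the
ball of generation `k` centered at `z`. -/
def treeMeasure : ℕ → ℕ → E d → Measure (E d)
  | 0, k, z => ENNReal.ofReal (1 / P.r k ^ 2) • volume.restrict (closedBall z (P.r k))
  | n + 1, k, z => ∑ c ∈ P.children k z, treeMeasure n (k + 1) c

lemma treeMeasure_succ (n k : ℕ) (z : E d) :
    P.treeMeasure (n + 1) k z = ∑ c ∈ P.children k z, P.treeMeasure n (k + 1) c := rfl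

lemma card_children_mul {k : ℕ} {z : E d} (hz : z ∈ P.centers k) :
    ((P.children k z).card : ℝ) * (kappa d * P.r (k + 1) ^ (d - 2)) =
      kappa d * P.r k ^ (d - 2) := by
  have h1 := P.r_pos (k + 1)
  rw [P.card_children k z hz, div_pow]
  field_simp

lemma treeMeasure_univ (hd : 3 ≤ d) (n : ℕ) : ∀ {k : ℕ} {z : E d}, z ∈ P.centers k →
    P.treeMeasure n k z Set.univ = ENNReal.ofReal (kappa d * P.r k ^ (d - 2)) := by
  induction n with
  | zero =>
    intro k z _
    have h1 := P.r_pos k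
    have e : P.r k ^ d = P.r k ^ (d - 2) * P.r k ^ 2 := by
      rw [← pow_add]; congr 1; omega
    rw [treeMeasure, Measure.smul_apply, Measure.restrict_apply_univ,
      volume_closedBall_eq (by omega) _ h1.le, smul_eq_mul, ← ENNReal.ofReal_mul (by positivity), e]
    congr 1
    field_simp
  | succ n ih =>
    intro k z hz
    have hκ := kappa_pos d
    have h1 := P.r_pos (k + 1)
    rw [treeMeasure_succ, Measure.finsetSum_apply]
    rw [Finset.sum_congr rfl fun c hc => ih (P.mem_centers_succ.2 ⟨z, hz, hc⟩), Finset.sum_const,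
      nsmul_eq_mul, ← P.card_children_mul hz,
      ENNReal.ofReal_mul (Nat.cast_nonneg _), ENNReal.ofReal_natCast]

lemma integrable_treeMeasure {f : E d → ℝ}
    (hf : ∀ z R, IntegrableOn f (closedBall z R)) (n : ℕ) :
    ∀ (k : ℕ) (z : E d), Integrable f (P.treeMeasure n k z) := by
  induction n with
  | zero => exact fun k z => (hf z (P.r k)).smul_measure ENNReal.ofReal_ne_top
  | succ n ih =>
    intro k z
    rw [treeMeasure_succ, integrable_finsetSum_measure]
    exact fun c _ => ih (k + 1) c

end Tree

variable (P : Construction d (scaleRatio d))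

lemma norm_child_sub_add_le (hd : 3 ≤ d) {k : ℕ} {z c : E d} (hz : z ∈ P.centers k)
    (hc : c ∈ P.children k z) : ‖c - z‖ + 2 * P.r (k + 1) ≤ 2 * P.r k := by
  have h1 := P.norm_child_sub_le hz hc
  have h2 := P.deltaSucc_le_half hd k
  have h3 := P.eight_mul_r_succ_le k
  have h4 := P.r_pos k
  nlinarith

/-- The descendants of a ball stay in the concentric ball of twice the radius. -/
lemma treeMeasure_compl_closedBall (hd : 3 ≤ d) (n : ℕ) : ∀ {k : ℕ} {z : E d},
    z ∈ P.centers k → P.treeMeasure n k z (closedBall z (2 * P.r k))ᶜ = 0 := by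
  induction n with
  | zero =>
    intro k z _
    have h1 := P.r_pos k
    rw [treeMeasure, Measure.smul_apply,
      Measure.restrict_apply measurableSet_closedBall.compl]
    have : (closedBall z (2 * P.r k))ᶜ ∩ closedBall z (P.r k) = ∅ := by
      rw [← Set.disjoint_iff_inter_eq_empty, Set.disjoint_compl_left_iff_subset]
      exact closedBall_subset_closedBall (by linarith)
    simp [this]
  | succ n ih =>
    intro k z hz
    rw [treeMeasure_succ, Measure.finsetSum_apply]
    refine Finset.sum_eq_zero fun c hc => ?_
    refine measure_mono_null (Set.compl_subset_compl.2 ?_) (ih (P.mem_centers_succ.2 ⟨z, hz, hc⟩))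
    apply closedBall_subset_closedBall'
    have := P.norm_child_sub_add_le hd hz hc
    rw [dist_eq_norm]
    linarith

/-- Distinct balls of one generation are far apart compared with their radius. -/
lemma five_mul_r_le_norm_sub (hd : 3 ≤ d) (k : ℕ) : ∀ z ∈ P.centers k, ∀ z' ∈ P.centers k,
    z ≠ z' → 5 * P.r k ≤ ‖z - z'‖ := by
  induction k with
  | zero =>
    intro z hz z' hz' hne
    simp only [centers, centersOf, Finset.mem_singleton] at hz hz'
    exact absurd (hz.trans hz'.symm) hne
  | succ k ih =>
    intro c hc c' hc' hne
    obtain ⟨z, hz, hcz⟩ := P.mem_centers_succ.1 hc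
    obtain ⟨z', hz', hcz'⟩ := P.mem_centers_succ.1 hc'
    have hr := P.r_pos (k + 1)
    rcases eq_or_ne z z' with rfl | hzz
    · have h1 := P.side_le_norm_sub hz hcz hcz' hne
      have h2 := P.eight_mul_r_succ_le_side hd k
      linarith
    · have h1 := ih z hz z' hz' hzz
      have h2 := P.norm_child_sub_add_le hd hz hcz
      have h3 := P.norm_child_sub_add_le hd hz' hcz'
      have h4 := P.eight_mul_r_succ_le k
      have h5 : ‖z - z'‖ ≤ ‖c - z‖ + ‖c - c'‖ + ‖c' - z'‖ := by
        have e : z - z' = -(c - z) + (c - c') + (c' - z') := by abel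
        rw [e]
        refine (norm_add_le _ _).trans ?_
        gcongr
        refine (norm_add_le _ _).trans ?_
        rw [norm_neg]
      linarith

lemma disjoint_children (hd : 3 ≤ d) {k : ℕ} {z z' : E d} (hz : z ∈ P.centers k)
    (hz' : z' ∈ P.centers k) (hne : z ≠ z') : Disjoint (P.children k z) (P.children k z') := by
  rw [Finset.disjoint_left]
  intro c hc hc'
  have h1 := P.five_mul_r_le_norm_sub hd k z hz z' hz' hne
  have h2 := P.norm_child_sub_add_le hd hz hc
  have h3 := P.norm_child_sub_add_le hd hz' hc'
  have h4 := P.r_pos (k + 1)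
  have h6 := P.r_pos k
  have h5 : ‖z - z'‖ ≤ ‖c - z‖ + ‖c - z'‖ := by
    rw [norm_sub_rev c z]
    have := norm_add_le (z - c) (c - z')
    rwa [sub_add_sub_cancel] at this
  linarith

lemma sum_treeMeasure (hd : 3 ≤ d) (n : ℕ) : ∀ k : ℕ,
    ∑ z ∈ P.centers k, P.treeMeasure n k z = P.approx (k + n) := by
  induction n with
  | zero => intro k; rfl
  | succ n ih =>
    intro k
    rw [← Nat.add_assoc, Nat.add_right_comm, ← ih (k + 1)]
    simp only [treeMeasure_succ]
    classical
    have e : P.centers (k + 1) = (P.centers k).biUnion (P.children k) := by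
      ext c; simp [P.mem_centers_succ]
    rw [e, Finset.sum_biUnion]
    exact fun z hz z' hz' hne => P.disjoint_children hd hz hz' hne

lemma zero_mem_centers : (0 : E d) ∈ P.centers 0 := by simp [centers, centersOf]

lemma approx_eq_treeMeasure (hd : 3 ≤ d) (m : ℕ) : P.approx m = P.treeMeasure m 0 0 := by
  have := P.sum_treeMeasure hd m 0
  rw [zero_add] at this
  rw [← this]
  simp [centers, centersOf]

lemma treeMeasure_le_approx (hd : 3 ≤ d) (n : ℕ) {k : ℕ} {z : E d} (hz : z ∈ P.centers k) :
    P.treeMeasure n k z ≤ P.approx (k + n) := by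
  rw [← P.sum_treeMeasure hd n k]
  refine Measure.le_iff.2 fun s _ => ?_
  rw [Measure.finsetSum_apply]
  exact Finset.single_le_sum (f := fun z => P.treeMeasure n k z s) (fun _ _ => zero_le) hz

end Construction

end

/-! ### Packings by cubes and crude estimates -/

section

variable {d : ℕ} {Ω : E d → ℝ} {H α : ℝ≥0}

/-- The hypotheses on the angular part of the kernel. -/
structure IsAdmissible (H α : ℝ≥0) (Ω : E d → ℝ) : Prop where
  pos : 0 < α
  le_one : α ≤ 1
  even : EvenOnSphere d Ω
  holder : HolderOnWith H α Ω (sphere (0 : E d) 1)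
  meanZero : MeanZero d Ω
  moment : MomentCondition d Ω

namespace IsAdmissible

lemma abs_le (h : IsAdmissible H α Ω) (hd : 3 ≤ d) :
    ∀ ω ∈ sphere (0 : E d) 1, |Ω ω| ≤ 2 * H :=
  fun _ hω => abs_le_of_holder_of_meanZero (by omega) h.pos h.le_one h.holder h.meanZero hω

lemma abs_kernel_le (h : IsAdmissible H α Ω) (hd : 3 ≤ d) (x : E d) :
    |kernel d Ω x| ≤ 2 * H * ‖x‖ ^ (-((d : ℝ) - 2)) :=
  EvenSIO.abs_kernel_le hd (h.abs_le hd) x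

lemma integrableOn_kernel (h : IsAdmissible H α Ω) (hd : 3 ≤ d) (x : E d) {A : Set (E d)}
    (hA : volume A ≠ ⊤) : IntegrableOn (fun ζ => kernel d Ω (x - ζ)) A :=
  EvenSIO.integrableOn_kernel hd h.pos h.holder (h.abs_le hd) x hA

lemma abs_setIntegral_kernel_le (h : IsAdmissible H α Ω) (hd : 3 ≤ d) (x : E d) {A : Set (E d)}
    {t : ℝ} (ht : 0 < t) (hvol : volume A ≤ ENNReal.ofReal (t ^ d)) :
    |∫ ζ in A, kernel d Ω (x - ζ)| ≤ 2 * H * ((d * kappa d + 1) * t ^ 2) := by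
  have hd3 : (3 : ℝ) ≤ d := by exact_mod_cast hd
  obtain ⟨hi, hle⟩ := integral_norm_rpow_le (s := (d : ℝ) - 2) (by omega) (by linarith)
    (by linarith) ht hvol x
  rw [sub_sub_cancel, Real.rpow_ofNat] at hle
  rw [← Real.norm_eq_abs]
  calc ‖∫ ζ in A, kernel d Ω (x - ζ)‖
      ≤ ∫ ζ in A, 2 * H * ‖x - ζ‖ ^ (-((d : ℝ) - 2)) :=
        norm_integral_le_of_norm_le (hi.const_mul _)
          (Eventually.of_forall fun ζ => h.abs_kernel_le hd _)
    _ = 2 * H * ∫ ζ in A, ‖x - ζ‖ ^ (-((d : ℝ) - 2)) := integral_const_mul _ _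
    _ ≤ _ := by gcongr

end IsAdmissible

lemma restrict_biUnion_finset₀ {X ι : Type*} [MeasurableSpace X] {ν : Measure X} (S : Finset ι)
    {Q : ι → Set X} (hQ : ∀ c ∈ S, MeasurableSet (Q c))
    (hdis : ∀ c ∈ S, ∀ c' ∈ S, c ≠ c' → AEDisjoint ν (Q c) (Q c')) :
    ν.restrict (⋃ c ∈ S, Q c) = ∑ c ∈ S, ν.restrict (Q c) := by
  classical
  induction S using Finset.induction_on with
  | empty => simp
  | insert a S ha ih =>
    rw [Finset.set_biUnion_insert, Finset.sum_insert ha, ← ih, Measure.restrict_union₀]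
    · rw [AEDisjoint, Set.inter_iUnion₂]
      refine (measure_biUnion_null_iff S.countable_toSet).2 fun c hc => ?_
      exact hdis a (Finset.mem_insert_self _ _) c (Finset.mem_insert_of_mem hc)
        (fun h => ha (h ▸ hc))
    · exact (Finset.measurableSet_biUnion _ fun c hc =>
        hQ c (Finset.mem_insert_of_mem hc)).nullMeasurableSet
    · exact fun c hc => hQ c (Finset.mem_insert_of_mem hc)
    · exact fun c hc c' hc' =>
        hdis c (Finset.mem_insert_of_mem hc) c' (Finset.mem_insert_of_mem hc')

/-- The constant in the comparison of `‖x - c‖` with the distance from `x` to the other points of a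
cube centered at `c`. -/
def cellConst (d : ℕ) : ℝ := (1 + √d) ^ d

/-- The constant in the estimate of the Riesz potentials of a packing. -/
def packConst (d : ℕ) : ℝ := (d * kappa d + 1) * (1 + kappa d) ^ d

lemma cellConst_pos (d : ℕ) : 0 < cellConst d := by unfold cellConst; positivity

lemma packConst_pos (d : ℕ) : 0 < packConst d := by
  have := kappa_pos d
  unfold packConst; positivity

/-- If `x` is not close to the center of a cube, the value of a Riesz kernel at the center is
controlled by its average over the cube. -/
lemma pow_mul_norm_rpow_le {s l : ℝ} (hd : 0 < d) (hs0 : 0 ≤ s) (hs : s ≤ d - 1) (hl : 0 < l)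
    {x c : E d} (hxc : l / 2 ≤ ‖x - c‖) :
    l ^ d * ‖x - c‖ ^ (-s) ≤ cellConst d * ∫ ζ in cube d c l, ‖x - ζ‖ ^ (-s) := by
  have : Nonempty (Fin d) := ⟨⟨0, hd⟩⟩
  have hvol := volume_cube c hl.le
  have hpos : 0 < ‖x - c‖ := by linarith
  have hi := (integral_norm_rpow_le hd hs0 hs hl hvol.le x).1
  have hq : (1 : ℝ) ≤ 1 + √d := by linarith [Real.sqrt_nonneg d]
  have hle : ∫ _ζ in cube d c l, (1 + √d) ^ (-s) * ‖x - c‖ ^ (-s) ≤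
      ∫ ζ in cube d c l, ‖x - ζ‖ ^ (-s) := by
    have hne : ∀ᵐ ζ ∂(volume : Measure (E d)), ζ ≠ x := by
      simp [ae_iff]
    refine setIntegral_mono_on_ae (integrableOn_const (by simp [hvol])) hi
      (isClosed_cube c l).measurableSet ?_
    filter_upwards [hne] with ζ hζ hmem
    have h1 : 0 < ‖x - ζ‖ := norm_pos_iff.2 (sub_ne_zero.2 hζ.symm)
    have h2 : ‖x - ζ‖ ≤ (1 + √d) * ‖x - c‖ := by
      have := norm_sub_le_of_mem_cube hmem
      have h3 : ‖x - ζ‖ ≤ ‖x - c‖ + ‖ζ - c‖ := by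
        rw [norm_sub_rev ζ c]
        have := norm_add_le (x - c) (c - ζ)
        rwa [sub_add_sub_cancel] at this
      nlinarith [Real.sqrt_nonneg d]
    rw [← Real.mul_rpow (by positivity) hpos.le]
    exact Real.rpow_le_rpow_of_nonpos h1 h2 (by linarith)
  rw [setIntegral_const, measureReal_def, hvol, ENNReal.toReal_ofReal (by positivity),
    smul_eq_mul] at hle
  have hc : 1 ≤ cellConst d * (1 + √d) ^ (-s) := by
    rw [cellConst, ← Real.rpow_natCast, ← Real.rpow_add (by linarith)]
    exact Real.one_le_rpow hq (by linarith)
  have hn : 0 ≤ l ^ d * ‖x - c‖ ^ (-s) := by positivity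
  calc l ^ d * ‖x - c‖ ^ (-s)
      ≤ (cellConst d * (1 + √d) ^ (-s)) * (l ^ d * ‖x - c‖ ^ (-s)) := le_mul_of_one_le_left hn hc
    _ = cellConst d * (l ^ d * ((1 + √d) ^ (-s) * ‖x - c‖ ^ (-s))) := by ring
    _ ≤ _ := by
        have := cellConst_pos d
        gcongr

namespace Construction

section

variable {B : ℝ} (P : Construction d B)

/-- The union of the cubes in the packing of the ball of generation `k` centered at `z`. -/
def packing (k : ℕ) (z : E d) : Set (E d) := ⋃ c ∈ P.children k z, cube d c (P.side k)

variable {k : ℕ} {z : E d}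

lemma measurableSet_packing : MeasurableSet (P.packing k z) :=
  Finset.measurableSet_biUnion _ fun _ _ => (isClosed_cube _ _).measurableSet

lemma packing_subset (hz : z ∈ P.centers k) :
    P.packing k z ⊆ closedBall z ((1 + deltaSucc d P.r k) * P.r k) :=
  Set.iUnion₂_subset fun c hc => P.cube_subset k z hz c hc

lemma restrict_packing (hz : z ∈ P.centers k) :
    (volume : Measure (E d)).restrict (P.packing k z) =
      ∑ c ∈ P.children k z, volume.restrict (cube d c (P.side k)) :=
  restrict_biUnion_finset₀ _ (fun _ _ => (isClosed_cube _ _).measurableSet)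
    (P.disjoint_cubes k z hz)

/-- A child carries the mass of its cube, for the density of the parent. -/
lemma mass_child (hd : 3 ≤ d) (k : ℕ) :
    kappa d * P.r (k + 1) ^ (d - 2) = (P.r k ^ 2)⁻¹ * P.side k ^ d := by
  have := P.r_pos k
  rw [P.side_pow hd]
  field_simp

lemma volume_packing (hd : 3 ≤ d) (hz : z ∈ P.centers k) :
    volume (P.packing k z) = ENNReal.ofReal (kappa d * P.r k ^ d) := by
  have h0 := P.r_pos k
  rw [← Measure.restrict_apply_univ, P.restrict_packing hz, Measure.finsetSum_apply]
  simp only [Measure.restrict_apply_univ, volume_cube _ (P.side_pos k).le, Finset.sum_const,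
    nsmul_eq_mul]
  rw [← ENNReal.ofReal_natCast, ← ENNReal.ofReal_mul (Nat.cast_nonneg _)]
  congr 1
  have e := P.card_children_mul hz
  rw [P.mass_child hd] at e
  have e1 : P.r k ^ d = P.r k ^ (d - 2) * P.r k ^ 2 := by
    rw [← pow_add]; congr 1; omega
  rw [e1, ← mul_assoc, ← e]
  field_simp

lemma integrableOn_cube_of_packing {f : E d → ℝ} (hf : IntegrableOn f (P.packing k z)) {c : E d}
    (hc : c ∈ P.children k z) : IntegrableOn f (cube d c (P.side k)) :=
  hf.mono_set (Set.subset_biUnion_of_mem (u := fun c => cube d c (P.side k)) hc)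

lemma sum_setIntegral_cube (hz : z ∈ P.centers k) {f : E d → ℝ}
    (hf : IntegrableOn f (P.packing k z)) :
    ∑ c ∈ P.children k z, ∫ ζ in cube d c (P.side k), f ζ = ∫ ζ in P.packing k z, f ζ := by
  rw [P.restrict_packing hz, integral_finsetSum_measure]
  exact fun c hc => P.integrableOn_cube_of_packing hf hc

/-- Riesz potentials of a packing are controlled by the radius of the packed ball. -/
lemma sum_riesz_le (hd : 3 ≤ d) (hz : z ∈ P.centers k) {s : ℝ} (hs0 : 0 ≤ s) (hs : s ≤ d - 1)
    (x : E d) {T : Finset (E d)} (hT : T ⊆ P.children k z) :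
    ∑ c ∈ T, ∫ ζ in cube d c (P.side k), ‖x - ζ‖ ^ (-s) ≤ packConst d * P.r k ^ (d - s) := by
  have hκ := kappa_pos d
  have h0 := P.r_pos k
  have hvol : volume (P.packing k z) ≤ ENNReal.ofReal (((1 + kappa d) * P.r k) ^ d) := by
    rw [P.volume_packing hd hz, mul_pow]
    refine ENNReal.ofReal_le_ofReal ?_
    gcongr
    have := le_self_pow₀ (a := 1 + kappa d) (by linarith) (by omega : d ≠ 0)
    linarith
  obtain ⟨hi, hle⟩ := integral_norm_rpow_le (by omega) hs0 hs (by positivity) hvol x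
  calc ∑ c ∈ T, ∫ ζ in cube d c (P.side k), ‖x - ζ‖ ^ (-s)
      ≤ ∑ c ∈ P.children k z, ∫ ζ in cube d c (P.side k), ‖x - ζ‖ ^ (-s) :=
        Finset.sum_le_sum_of_subset_of_nonneg hT fun c _ _ =>
          integral_nonneg fun ζ => by positivity
    _ = ∫ ζ in P.packing k z, ‖x - ζ‖ ^ (-s) := P.sum_setIntegral_cube hz hi
    _ ≤ (d * kappa d + 1) * ((1 + kappa d) * P.r k) ^ (d - s) := hle
    _ = (d * kappa d + 1) * ((1 + kappa d) ^ (d - s) * P.r k ^ (d - s)) := by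
        rw [Real.mul_rpow (by positivity) h0.le]
    _ ≤ (d * kappa d + 1) * ((1 + kappa d) ^ d * P.r k ^ (d - s)) := by
        gcongr
        rw [← Real.rpow_natCast]
        exact Real.rpow_le_rpow_of_exponent_le (by linarith) (by linarith)
    _ = _ := by rw [packConst]; ring

lemma children_nonempty (hz : z ∈ P.centers k) : (P.children k z).Nonempty := by
  have h0 := P.r_pos k
  have h1 := P.r_pos (k + 1)
  have h : (0 : ℝ) < (P.children k z).card := by
    rw [P.card_children k z hz]; positivity
  exact Finset.card_pos.1 (by exact_mod_cast h)

/-- All children except the nearest one are at distance at least half a side length. -/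
lemma exists_nearest_child (hz : z ∈ P.centers k) (x : E d) :
    ∃ c₀ ∈ P.children k z, ∀ c ∈ P.children k z, c ≠ c₀ → P.side k / 2 ≤ ‖x - c‖ := by
  obtain ⟨c₀, hc₀, hmin⟩ := Finset.exists_min_image _ (fun c => ‖x - c‖) (P.children_nonempty hz)
  refine ⟨c₀, hc₀, fun c hc hne => ?_⟩
  have h1 := P.side_le_norm_sub hz hc hc₀ hne
  have h2 := hmin c hc
  have h3 : ‖c - c₀‖ ≤ ‖x - c‖ + ‖x - c₀‖ := by
    rw [norm_sub_rev x c]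
    have := norm_add_le (c - x) (x - c₀)
    rwa [sub_add_sub_cancel] at this
  linarith

end

variable (P : Construction d (scaleRatio d)) {k : ℕ} {z : E d}

lemma isFiniteMeasure_treeMeasure (hd : 3 ≤ d) (n : ℕ) (hz : z ∈ P.centers k) :
    IsFiniteMeasure (P.treeMeasure n k z) :=
  ⟨by rw [P.treeMeasure_univ hd n hz]; exact ENNReal.ofReal_lt_top⟩

lemma treeMeasure_real_univ (hd : 3 ≤ d) (n : ℕ) (hz : z ∈ P.centers k) :
    (P.treeMeasure n k z).real Set.univ = kappa d * P.r k ^ (d - 2) := by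
  have := kappa_pos d
  have := P.r_pos k
  rw [measureReal_def, P.treeMeasure_univ hd n hz, ENNReal.toReal_ofReal (by positivity)]

lemma abs_integral_treeMeasure_le (hd : 3 ≤ d) (n : ℕ) (hz : z ∈ P.centers k) {f : E d → ℝ} {b : ℝ}
    (hb : ∀ ζ ∈ closedBall z (2 * P.r k), |f ζ| ≤ b) :
    |∫ ζ, f ζ ∂(P.treeMeasure n k z)| ≤ b * (kappa d * P.r k ^ (d - 2)) := by
  have := P.isFiniteMeasure_treeMeasure hd n hz
  rw [← P.treeMeasure_real_univ hd n hz, ← Real.norm_eq_abs]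
  refine norm_integral_le_of_norm_le_const ?_
  filter_upwards [mem_ae_iff.2 (P.treeMeasure_compl_closedBall hd n hz)] with ζ hζ
  exact hb ζ hζ

lemma integrable_kernel_treeMeasure (h : IsAdmissible H α Ω) (hd : 3 ≤ d) (n k : ℕ) (x z : E d) :
    Integrable (fun ζ => kernel d Ω (x - ζ)) (P.treeMeasure n k z) :=
  P.integrable_treeMeasure
    (fun _ _ => h.integrableOn_kernel hd x measure_closedBall_lt_top.ne) n k z

lemma norm_sub_le_two_mul {x c ζ : E d} {a : ℝ} (h1 : ‖ζ - c‖ ≤ a) (h2 : 2 * a ≤ ‖x - c‖) :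
    ‖x - c‖ ≤ 2 * ‖x - ζ‖ := by
  have : ‖x - c‖ ≤ ‖x - ζ‖ + ‖ζ - c‖ := by
    have := norm_add_le (x - ζ) (ζ - c)
    rwa [sub_add_sub_cancel] at this
  linarith

lemma norm_rpow_neg_le {s : ℝ} (hs0 : 0 ≤ s) (hs : s ≤ d) {u v : E d} (hv : v ≠ 0)
    (h : ‖v‖ ≤ 2 * ‖u‖) : ‖u‖ ^ (-s) ≤ 2 ^ d * ‖v‖ ^ (-s) := by
  have hv' := norm_pos_iff.2 hv
  have h1 : ‖u‖ ^ (-s) ≤ (‖v‖ / 2) ^ (-s) :=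
    Real.rpow_le_rpow_of_nonpos (by positivity) (by linarith) (by linarith)
  refine h1.trans ?_
  rw [Real.div_rpow hv'.le (by norm_num), Real.rpow_neg (x := 2) (by norm_num), div_inv_eq_mul,
    mul_comm]
  gcongr
  rw [← Real.rpow_natCast]
  exact Real.rpow_le_rpow_of_exponent_le (by norm_num) hs

/-- A ball that is not close to `x` contributes a bounded amount at `x`, whatever its
descendants. -/
lemma abs_integral_kernel_far_le (h : IsAdmissible H α Ω) (hd : 3 ≤ d) (n : ℕ)
    (hz : z ∈ P.centers k) {x : E d} (hx : 3 * P.r k ≤ ‖x - z‖) :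
    |∫ ζ, kernel d Ω (x - ζ) ∂(P.treeMeasure n k z)| ≤ 2 * H * kappa d := by
  have h0 := P.r_pos k
  have hd3 : (3 : ℝ) ≤ d := by exact_mod_cast hd
  have hb : ∀ ζ ∈ closedBall z (2 * P.r k),
      |kernel d Ω (x - ζ)| ≤ 2 * H * P.r k ^ (-((d : ℝ) - 2)) := by
    intro ζ hζ
    rw [mem_closedBall, dist_eq_norm] at hζ
    have h1 : P.r k ≤ ‖x - ζ‖ := by
      have := norm_add_le (x - ζ) (ζ - z)
      rw [sub_add_sub_cancel] at this
      linarith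
    refine (h.abs_kernel_le hd _).trans ?_
    gcongr ?_ * ?_
    exact Real.rpow_le_rpow_of_nonpos h0 h1 (by linarith)
  refine (P.abs_integral_treeMeasure_le hd n hz hb).trans (le_of_eq ?_)
  rw [Real.rpow_neg h0.le, show ((d : ℝ) - 2) = ((d - 2 : ℕ) : ℝ) by
    rw [Nat.cast_sub (by omega)]; simp, Real.rpow_natCast]
  field_simp

lemma side_half_ge (hd : 3 ≤ d) (k : ℕ) : 2 * (2 * P.r (k + 1)) ≤ P.side k / 2 := by
  linarith [P.eight_mul_r_succ_le_side hd k]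

lemma abs_integral_kernel_child_le (h : IsAdmissible H α Ω) (hd : 3 ≤ d) (n : ℕ)
    (hz : z ∈ P.centers k) {c x : E d} (hc : c ∈ P.children k z)
    (hxc : P.side k / 2 ≤ ‖x - c‖) :
    |∫ ζ, kernel d Ω (x - ζ) ∂(P.treeMeasure n (k + 1) c)| ≤
      2 * H * 2 ^ d * cellConst d * (P.r k ^ 2)⁻¹ *
        ∫ ζ in cube d c (P.side k), ‖x - ζ‖ ^ (-((d : ℝ) - 2)) := by
  have hd3 : (3 : ℝ) ≤ d := by exact_mod_cast hd
  have hl := P.side_pos k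
  have hr := P.r_pos k
  have hne : x - c ≠ 0 := norm_pos_iff.1 (by linarith)
  have hb : ∀ ζ ∈ closedBall c (2 * P.r (k + 1)),
      |kernel d Ω (x - ζ)| ≤ 2 * H * (2 ^ d * ‖x - c‖ ^ (-((d : ℝ) - 2))) := by
    intro ζ hζ
    rw [mem_closedBall, dist_eq_norm] at hζ
    refine (h.abs_kernel_le hd _).trans ?_
    gcongr
    exact norm_rpow_neg_le (by linarith) (by linarith) hne
      (norm_sub_le_two_mul hζ ((P.side_half_ge hd k).trans hxc))
  refine (P.abs_integral_treeMeasure_le hd n (P.mem_centers_succ.2 ⟨z, hz, hc⟩) hb).trans ?_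
  have h1 := pow_mul_norm_rpow_le (s := (d : ℝ) - 2) (by omega) (by linarith) (by linarith) hl hxc
  rw [P.mass_child hd]
  calc _ = 2 * H * 2 ^ d * (P.r k ^ 2)⁻¹ * (P.side k ^ d * ‖x - c‖ ^ (-((d : ℝ) - 2))) := by ring
    _ ≤ 2 * H * 2 ^ d * (P.r k ^ 2)⁻¹ * (cellConst d *
        ∫ ζ in cube d c (P.side k), ‖x - ζ‖ ^ (-((d : ℝ) - 2))) := by gcongr
    _ = _ := by ring

/-- All children except the nearest one together contribute a bounded amount. -/
lemma abs_sum_children_le (h : IsAdmissible H α Ω) (hd : 3 ≤ d) (n : ℕ)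
    (hz : z ∈ P.centers k) {x : E d} {T : Finset (E d)} (hT : T ⊆ P.children k z)
    (hx : ∀ c ∈ T, P.side k / 2 ≤ ‖x - c‖) :
    |∑ c ∈ T, ∫ ζ, kernel d Ω (x - ζ) ∂(P.treeMeasure n (k + 1) c)| ≤
      2 * H * 2 ^ d * cellConst d * packConst d := by
  have hd3 : (3 : ℝ) ≤ d := by exact_mod_cast hd
  have hr := P.r_pos k
  have hC := cellConst_pos d
  have hs := P.sum_riesz_le hd hz (s := (d : ℝ) - 2) (by linarith) (by linarith) x hT
  rw [sub_sub_cancel, Real.rpow_ofNat] at hs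
  calc _ ≤ ∑ c ∈ T, |∫ ζ, kernel d Ω (x - ζ) ∂(P.treeMeasure n (k + 1) c)| :=
        Finset.abs_sum_le_sum_abs _ _
    _ ≤ ∑ c ∈ T, 2 * H * 2 ^ d * cellConst d * (P.r k ^ 2)⁻¹ *
        ∫ ζ in cube d c (P.side k), ‖x - ζ‖ ^ (-((d : ℝ) - 2)) :=
        Finset.sum_le_sum fun c hc => P.abs_integral_kernel_child_le h hd n hz (hT hc) (hx c hc)
    _ = 2 * H * 2 ^ d * cellConst d * (P.r k ^ 2)⁻¹ *
        ∑ c ∈ T, ∫ ζ in cube d c (P.side k), ‖x - ζ‖ ^ (-((d : ℝ) - 2)) := by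
        rw [Finset.mul_sum]
    _ ≤ 2 * H * 2 ^ d * cellConst d * (P.r k ^ 2)⁻¹ * (packConst d * P.r k ^ 2) := by gcongr
    _ = _ := by field_simp

end Construction

end

/-! ### The cancellation at one scale -/

section

variable {d : ℕ} {Ω : E d → ℝ} {H α : ℝ≥0}

/-- The Hölder constant of the kernel. -/
def holderConst (d : ℕ) (H : ℝ≥0) : ℝ := 2 * H + d * (2 * H)

lemma holderConst_nonneg (d : ℕ) (H : ℝ≥0) : 0 ≤ holderConst d H := by
  unfold holderConst; positivity

lemma IsAdmissible.abs_kernel_sub_le (h : IsAdmissible H α Ω) (hd : 3 ≤ d) (u v : E d) :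
    |kernel d Ω u - kernel d Ω v| ≤ holderConst d H * (‖u - v‖ ^ (α : ℝ) *
      (‖u‖ ^ (-((d : ℝ) - 2 + α)) + ‖v‖ ^ (-((d : ℝ) - 2 + α)))) :=
  EvenSIO.abs_kernel_sub_le hd h.pos h.le_one h.holder (h.abs_le hd) u v

lemma one_add_pow_sub_one_le {y : ℝ} (hy0 : 0 ≤ y) (hy1 : y ≤ 1) (n : ℕ) :
    (1 + y) ^ n - 1 ≤ (2 ^ n - 1) * y := by
  induction n with
  | zero => simp
  | succ n ih =>
    have h2 : (1 : ℝ) ≤ 2 ^ n := one_le_pow₀ (by norm_num)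
    have h3 : 0 ≤ ((2 : ℝ) ^ n - 1) * (y * (1 - y)) :=
      mul_nonneg (by linarith) (mul_nonneg hy0 (by linarith))
    calc (1 + y) ^ (n + 1) - 1 = ((1 + y) ^ n - 1) * (1 + y) + y := by ring
      _ ≤ ((2 ^ n - 1) * y) * (1 + y) + y := by gcongr
      _ ≤ (2 ^ (n + 1) - 1) * y := by rw [pow_succ]; linarith

/-- The constant in the comparison of the descendants of a ball with its cube. -/
def swapConst (d : ℕ) (H : ℝ≥0) : ℝ :=
  holderConst d H * ((2 ^ d + 1 + d) * cellConst d + d)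

lemma swapConst_nonneg (d : ℕ) (H : ℝ≥0) : 0 ≤ swapConst d H := by
  have := holderConst_nonneg d H
  have := cellConst_pos d
  unfold swapConst; positivity

namespace Construction

variable (P : Construction d (scaleRatio d)) {k : ℕ} {z : E d}

/-- Replacing the descendants of a ball by the uniform measure on the surrounding cube changes the
potential little: both measures have the same mass and lie close to the center of the cube. -/
lemma abs_integral_child_sub_cube_le (h : IsAdmissible H α Ω) (hd : 3 ≤ d) (n : ℕ)
    (hz : z ∈ P.centers k) {c x : E d} (hc : c ∈ P.children k z)
    (hxc : P.side k / 2 ≤ ‖x - c‖) :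
    |(∫ ζ, kernel d Ω (x - ζ) ∂(P.treeMeasure n (k + 1) c)) -
      (P.r k ^ 2)⁻¹ * ∫ ζ in cube d c (P.side k), kernel d Ω (x - ζ)| ≤
      swapConst d H * (P.r k ^ 2)⁻¹ * P.side k ^ (α : ℝ) *
        ∫ ζ in cube d c (P.side k), ‖x - ζ‖ ^ (-((d : ℝ) - 2 + α)) := by
  have hd3 : (3 : ℝ) ≤ d := by exact_mod_cast hd
  have hα1 : (α : ℝ) ≤ 1 := by exact_mod_cast h.le_one
  have hα : (0 : ℝ) < α := by exact_mod_cast h.pos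
  have hl := P.side_pos k
  have hr := P.r_pos k
  have hr1 := P.r_pos (k + 1)
  have hL := holderConst_nonneg d H
  have hpos : 0 < ‖x - c‖ := by linarith
  have hne : x - c ≠ 0 := norm_pos_iff.1 hpos
  set s : ℝ := (d : ℝ) - 2 + α with hs
  have hs0 : 0 ≤ s := by linarith
  have hs1 : s ≤ d - 1 := by linarith
  set l := P.side k with hldef
  set L := holderConst d H with hLdef
  set Q := cube d c l with hQ
  have hc' : c ∈ P.centers (k + 1) := P.mem_centers_succ.2 ⟨z, hz, hc⟩
  have hfin := P.isFiniteMeasure_treeMeasure hd n hc'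
  have hvol : volume Q = ENNReal.ofReal (l ^ d) := volume_cube c hl.le
  have hQfin : volume Q ≠ ⊤ := by rw [hvol]; exact ENNReal.ofReal_ne_top
  set K0 := kernel d Ω (x - c) with hK0
  set J := ∫ ζ in Q, ‖x - ζ‖ ^ (-s) with hJ
  have hcell : l ^ d * ‖x - c‖ ^ (-s) ≤ cellConst d * J :=
    pow_mul_norm_rpow_le (by omega) hs0 hs1 hl hxc
  -- The kernel differs little from its value at the center on the support of the descendants.
  have h1 : |(∫ ζ, kernel d Ω (x - ζ) ∂(P.treeMeasure n (k + 1) c)) -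
      (P.r k ^ 2)⁻¹ * (l ^ d * K0)| ≤
      L * (l ^ (α : ℝ) * ((2 ^ d + 1) * ‖x - c‖ ^ (-s))) * ((P.r k ^ 2)⁻¹ * l ^ d) := by
    have e : (∫ ζ, kernel d Ω (x - ζ) ∂(P.treeMeasure n (k + 1) c)) -
        (P.r k ^ 2)⁻¹ * (l ^ d * K0) =
        ∫ ζ, (kernel d Ω (x - ζ) - K0) ∂(P.treeMeasure n (k + 1) c) := by
      rw [integral_sub (P.integrable_kernel_treeMeasure h hd n (k + 1) x c) (integrable_const _),
        integral_const, P.treeMeasure_real_univ hd n hc', P.mass_child hd, smul_eq_mul, mul_assoc]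
    rw [e, hldef, ← P.mass_child hd, ← hldef]
    refine P.abs_integral_treeMeasure_le hd n hc' fun ζ hζ => ?_
    rw [mem_closedBall, dist_eq_norm] at hζ
    refine (h.abs_kernel_sub_le hd _ _).trans ?_
    rw [sub_sub_sub_cancel_left, norm_sub_rev]
    have h3 := norm_rpow_neg_le hs0 (by linarith) hne
      (norm_sub_le_two_mul hζ ((P.side_half_ge hd k).trans hxc))
    have h4 : ‖ζ - c‖ ≤ l := hζ.trans (by linarith [P.eight_mul_r_succ_le_side hd k])
    gcongr
    rw [add_mul, one_mul]
    gcongr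
  -- The same holds on the cube.
  have hKi : IntegrableOn (fun ζ => kernel d Ω (x - ζ)) Q := h.integrableOn_kernel hd x hQfin
  have hRi : IntegrableOn (fun ζ => ‖x - ζ‖ ^ (-s)) Q :=
    (integral_norm_rpow_le (by omega) hs0 hs1 hl hvol.le x).1
  have hQreal : volume.real Q = l ^ d := by
    rw [measureReal_def, hvol, ENNReal.toReal_ofReal (by positivity)]
  have h2 : |(∫ ζ in Q, kernel d Ω (x - ζ)) - l ^ d * K0| ≤
      L * (d * l ^ (α : ℝ)) * (J + l ^ d * ‖x - c‖ ^ (-s)) := by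
    have e : (∫ ζ in Q, kernel d Ω (x - ζ)) - l ^ d * K0 =
        ∫ ζ in Q, (kernel d Ω (x - ζ) - K0) := by
      rw [integral_sub hKi (integrableOn_const hQfin), setIntegral_const, hQreal, smul_eq_mul]
    have hbi : IntegrableOn
        (fun ζ => L * (d * l ^ (α : ℝ)) * (‖x - ζ‖ ^ (-s) + ‖x - c‖ ^ (-s))) Q :=
      (hRi.add (integrableOn_const hQfin)).const_mul _
    have e2 : ∫ ζ in Q, L * (d * l ^ (α : ℝ)) * (‖x - ζ‖ ^ (-s) + ‖x - c‖ ^ (-s)) =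
        L * (d * l ^ (α : ℝ)) * (J + l ^ d * ‖x - c‖ ^ (-s)) := by
      rw [integral_const_mul, integral_add hRi (integrableOn_const hQfin), setIntegral_const,
        hQreal, smul_eq_mul]
    rw [e, ← e2, ← Real.norm_eq_abs]
    refine norm_integral_le_of_norm_le hbi ?_
    filter_upwards [ae_restrict_mem (isClosed_cube c l).measurableSet] with ζ hζ
    rw [Real.norm_eq_abs]
    refine (h.abs_kernel_sub_le hd _ _).trans ?_
    rw [sub_sub_sub_cancel_left, norm_sub_rev, mul_assoc L]
    have h4 : ‖ζ - c‖ ≤ d * l := by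
      have := norm_sub_le_of_mem_cube hζ
      have hsq : √d ≤ d := by
        rw [Real.sqrt_le_left (by positivity)]
        nlinarith
      nlinarith [Real.sqrt_nonneg d]
    gcongr
    calc ‖ζ - c‖ ^ (α : ℝ) ≤ (d * l) ^ (α : ℝ) := by gcongr
      _ = (d : ℝ) ^ (α : ℝ) * l ^ (α : ℝ) := Real.mul_rpow (by positivity) hl.le
      _ ≤ (d : ℝ) ^ (1 : ℝ) * l ^ (α : ℝ) := by
        gcongr
        linarith
      _ = d * l ^ (α : ℝ) := by rw [Real.rpow_one]
  have hJ0 : 0 ≤ J := integral_nonneg fun ζ => by positivity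
  have e : (∫ ζ, kernel d Ω (x - ζ) ∂(P.treeMeasure n (k + 1) c)) -
      (P.r k ^ 2)⁻¹ * ∫ ζ in Q, kernel d Ω (x - ζ) =
      ((∫ ζ, kernel d Ω (x - ζ) ∂(P.treeMeasure n (k + 1) c)) - (P.r k ^ 2)⁻¹ * (l ^ d * K0)) -
        (P.r k ^ 2)⁻¹ * ((∫ ζ in Q, kernel d Ω (x - ζ)) - l ^ d * K0) := by ring
  rw [e]
  refine (abs_sub _ _).trans ?_
  rw [abs_mul (P.r k ^ 2)⁻¹, abs_of_pos (by positivity : 0 < (P.r k ^ 2)⁻¹)]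
  calc _ ≤ L * (l ^ (α : ℝ) * ((2 ^ d + 1) * ‖x - c‖ ^ (-s))) * ((P.r k ^ 2)⁻¹ * l ^ d) +
        (P.r k ^ 2)⁻¹ * (L * (d * l ^ (α : ℝ)) * (J + l ^ d * ‖x - c‖ ^ (-s))) := by gcongr
    _ = L * (P.r k ^ 2)⁻¹ * l ^ (α : ℝ) *
        ((2 ^ d + 1 + d) * (l ^ d * ‖x - c‖ ^ (-s)) + d * J) := by ring
    _ ≤ L * (P.r k ^ 2)⁻¹ * l ^ (α : ℝ) * ((2 ^ d + 1 + d) * (cellConst d * J) + d * J) := by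
        gcongr
    _ = _ := by rw [swapConst]; ring

lemma side_le_deltaSucc_mul (hd : 3 ≤ d) (k : ℕ) : P.side k ≤ deltaSucc d P.r k * P.r k := by
  rw [P.deltaSucc_mul hd]
  have : (1 : ℝ) ≤ √d := by
    rw [Real.one_le_sqrt]
    exact_mod_cast (by omega : 1 ≤ d)
  nlinarith [P.side_pos k]

/-- The total error made when the children of a ball are replaced by their cubes. -/
lemma abs_sum_child_sub_cube_le (h : IsAdmissible H α Ω) (hd : 3 ≤ d) (n : ℕ)
    (hz : z ∈ P.centers k) {x : E d} {T : Finset (E d)} (hT : T ⊆ P.children k z)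
    (hx : ∀ c ∈ T, P.side k / 2 ≤ ‖x - c‖) :
    |∑ c ∈ T, ((∫ ζ, kernel d Ω (x - ζ) ∂(P.treeMeasure n (k + 1) c)) -
      (P.r k ^ 2)⁻¹ * ∫ ζ in cube d c (P.side k), kernel d Ω (x - ζ))| ≤
      swapConst d H * packConst d * deltaSucc d P.r k ^ (α : ℝ) := by
  have hd3 : (3 : ℝ) ≤ d := by exact_mod_cast hd
  have hα1 : (α : ℝ) ≤ 1 := by exact_mod_cast h.le_one
  have hα : (0 : ℝ) < α := by exact_mod_cast h.pos
  have hr := P.r_pos k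
  have hl := P.side_pos k
  have hδ := P.deltaSucc_pos hd k
  have hC := swapConst_nonneg d H
  have hC' := packConst_pos d
  have hs := P.sum_riesz_le hd hz (s := (d : ℝ) - 2 + α) (by linarith) (by linarith) x hT
  have e2 : P.r k ^ ((d : ℝ) - (d - 2 + α)) = P.r k ^ 2 * (P.r k ^ (α : ℝ))⁻¹ := by
    rw [show (d : ℝ) - (d - 2 + α) = (2 : ℕ) - α by push_cast; ring, Real.rpow_sub hr,
      Real.rpow_natCast, div_eq_mul_inv]
  rw [e2] at hs
  have hlr : P.side k ^ (α : ℝ) ≤ deltaSucc d P.r k ^ (α : ℝ) * P.r k ^ (α : ℝ) := by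
    rw [← Real.mul_rpow hδ.le hr.le]
    gcongr
    exact P.side_le_deltaSucc_mul hd k
  have hrα : 0 < P.r k ^ (α : ℝ) := by positivity
  calc _ ≤ ∑ c ∈ T, |(∫ ζ, kernel d Ω (x - ζ) ∂(P.treeMeasure n (k + 1) c)) -
      (P.r k ^ 2)⁻¹ * ∫ ζ in cube d c (P.side k), kernel d Ω (x - ζ)| :=
        Finset.abs_sum_le_sum_abs _ _
    _ ≤ ∑ c ∈ T, swapConst d H * (P.r k ^ 2)⁻¹ * P.side k ^ (α : ℝ) *
        ∫ ζ in cube d c (P.side k), ‖x - ζ‖ ^ (-((d : ℝ) - 2 + α)) :=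
        Finset.sum_le_sum fun c hc =>
          P.abs_integral_child_sub_cube_le h hd n hz (hT hc) (hx c hc)
    _ = swapConst d H * (P.r k ^ 2)⁻¹ * P.side k ^ (α : ℝ) *
        ∑ c ∈ T, ∫ ζ in cube d c (P.side k), ‖x - ζ‖ ^ (-((d : ℝ) - 2 + α)) := by
        rw [Finset.mul_sum]
    _ ≤ swapConst d H * (P.r k ^ 2)⁻¹ * (deltaSucc d P.r k ^ (α : ℝ) * P.r k ^ (α : ℝ)) *
        (packConst d * (P.r k ^ 2 * (P.r k ^ (α : ℝ))⁻¹)) := by gcongr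
    _ = _ := by field_simp

/-- The uniform measure on a packing has a small potential inside the packed ball: it nearly fills a
slightly larger ball, whose potential vanishes there. -/
lemma abs_setIntegral_packing_le (h : IsAdmissible H α Ω) (hd : 3 ≤ d) (hz : z ∈ P.centers k)
    {x : E d} (hx : ‖x - z‖ ≤ (1 + 2 * deltaSucc d P.r k) * P.r k) :
    |(P.r k ^ 2)⁻¹ * ∫ ζ in P.packing k z, kernel d Ω (x - ζ)| ≤
      2 * H * (d * kappa d + 1) * (16 * (1 + kappa d) ^ 2) *
        deltaSucc d P.r k ^ (2 / (d : ℝ)) := by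
  have hκ := kappa_pos d
  have hr := P.r_pos k
  have hδ := P.deltaSucc_pos hd k
  have hδ2 := P.deltaSucc_le_half hd k
  have hd0 : d ≠ 0 := by omega
  set δ := deltaSucc d P.r k with hδdef
  set R := (1 + 2 * δ) * P.r k with hR
  have hsub : P.packing k z ⊆ closedBall z R :=
    (P.packing_subset hz).trans (closedBall_subset_closedBall (by rw [hR]; gcongr; linarith))
  have hfin : volume (closedBall z R) ≠ ⊤ := measure_closedBall_lt_top.ne
  have hKi : IntegrableOn (fun ζ => kernel d Ω (x - ζ)) (closedBall z R) :=
    h.integrableOn_kernel hd x hfin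
  have hsplit := setIntegral_sdiff P.measurableSet_packing hKi hsub
  rw [integral_closedBall_kernel_eq_zero hd h.pos h.le_one h.even h.holder h.meanZero h.moment hx,
    zero_sub] at hsplit
  set t := 4 * (1 + kappa d) * δ ^ (1 / (d : ℝ)) * P.r k with ht
  have ht0 : 0 < t := by positivity
  have hvol : volume (closedBall z R \ P.packing k z) ≤ ENNReal.ofReal (t ^ d) := by
    rw [measure_sdiff hsub P.measurableSet_packing.nullMeasurableSet
      ((measure_mono hsub).trans_lt hfin.lt_top).ne, P.volume_packing hd hz,
      volume_closedBall_eq (by omega) _ (by positivity), ← ENNReal.ofReal_sub _ (by positivity)]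
    refine ENNReal.ofReal_le_ofReal ?_
    have h1 := one_add_pow_sub_one_le (y := 2 * δ) (by positivity) (by linarith) d
    have h2 : (δ ^ (1 / (d : ℝ))) ^ d = δ := by rw [one_div, Real.rpow_inv_natCast_pow hδ.le hd0]
    rw [hR, ht, mul_pow, mul_pow _ (P.r k), mul_pow _ (δ ^ _), h2, mul_pow]
    have h3 : kappa d ≤ (1 + kappa d) ^ d := by
      have := le_self_pow₀ (a := 1 + kappa d) (by linarith) hd0
      linarith
    have h4 : ((2 : ℝ) ^ d - 1) * 2 ≤ 4 ^ d := by
      have : (4 : ℝ) ^ d = 2 ^ d * 2 ^ d := by rw [← mul_pow]; norm_num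
      have h5 : (2 : ℝ) ≤ 2 ^ d := le_self_pow₀ (by norm_num) hd0
      nlinarith
    calc kappa d * ((1 + 2 * δ) ^ d * P.r k ^ d) - kappa d * P.r k ^ d
        = kappa d * ((1 + 2 * δ) ^ d - 1) * P.r k ^ d := by ring
      _ ≤ (1 + kappa d) ^ d * (4 ^ d * δ) * P.r k ^ d := by
          gcongr
          · have := one_le_pow₀ (n := d) (a := 1 + 2 * δ) (by linarith)
            linarith
          · refine h1.trans ?_
            rw [← mul_assoc]
            gcongr
      _ = _ := by ring
  have hfinal := h.abs_setIntegral_kernel_le hd x ht0 hvol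
  rw [hsplit, abs_neg] at hfinal
  rw [abs_mul, abs_of_pos (by positivity : 0 < (P.r k ^ 2)⁻¹)]
  have h6 : (δ ^ (1 / (d : ℝ))) ^ 2 = δ ^ (2 / (d : ℝ)) := by
    rw [← Real.rpow_natCast, ← Real.rpow_mul hδ.le]
    congr 1
    push_cast
    ring
  calc _ ≤ (P.r k ^ 2)⁻¹ * (2 * H * ((d * kappa d + 1) * t ^ 2)) := by gcongr
    _ = _ := by
      rw [ht, mul_pow, mul_pow _ (δ ^ _), h6]
      field_simp
      ring

/-- The constant in the estimate of the potential of one generation. -/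
def stepConst (d : ℕ) (H : ℝ≥0) : ℝ :=
  swapConst d H * packConst d + 2 * H * (d * kappa d + 1) * (16 * (1 + kappa d) ^ 2) +
    2 * H * (d * kappa d + 1)

/-- If `x` lies in a slightly enlarged ball of the construction, all children of this ball except
the one nearest to `x` together have a small potential at `x`. -/
lemma abs_sum_erase_le (h : IsAdmissible H α Ω) (hd : 3 ≤ d) (n : ℕ) [DecidableEq (E d)]
    (hz : z ∈ P.centers k) {x c₀ : E d} (hc₀ : c₀ ∈ P.children k z)
    (hx : ‖x - z‖ ≤ (1 + 2 * deltaSucc d P.r k) * P.r k)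
    (hnear : ∀ c ∈ P.children k z, c ≠ c₀ → P.side k / 2 ≤ ‖x - c‖) :
    |∑ c ∈ (P.children k z).erase c₀, ∫ ζ, kernel d Ω (x - ζ) ∂(P.treeMeasure n (k + 1) c)| ≤
      stepConst d H * deltaSucc d P.r k ^ (2 * (α : ℝ) / d) := by
  have hd3 : (3 : ℝ) ≤ d := by exact_mod_cast hd
  have hα1 : (α : ℝ) ≤ 1 := by exact_mod_cast h.le_one
  have hα : (0 : ℝ) < α := by exact_mod_cast h.pos
  have hκ := kappa_pos d
  have hr := P.r_pos k
  have hl := P.side_pos k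
  have hδ := P.deltaSucc_pos hd k
  have hδ1 : deltaSucc d P.r k ≤ 1 := (P.deltaSucc_le_half hd k).trans (by norm_num)
  have hsw := swapConst_nonneg d H
  have hpk := packConst_pos d
  have hpack : IntegrableOn (fun ζ => kernel d Ω (x - ζ)) (P.packing k z) :=
    h.integrableOn_kernel hd x (by rw [P.volume_packing hd hz]; exact ENNReal.ofReal_ne_top)
  have b1 := P.abs_sum_child_sub_cube_le h hd n hz (x := x)
    ((P.children k z).erase_subset c₀) fun c hc =>
      hnear c (Finset.mem_of_mem_erase hc) (Finset.ne_of_mem_erase hc)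
  have b2 := P.abs_setIntegral_packing_le h hd hz hx
  have b3 := h.abs_setIntegral_kernel_le hd x hl (volume_cube c₀ hl.le).le
  set δ := deltaSucc d P.r k with hδdef
  have b3' : |(P.r k ^ 2)⁻¹ * ∫ ζ in cube d c₀ (P.side k), kernel d Ω (x - ζ)| ≤
      2 * H * (d * kappa d + 1) * δ ^ (2 : ℝ) := by
    rw [abs_mul, abs_of_pos (by positivity : 0 < (P.r k ^ 2)⁻¹), Real.rpow_ofNat]
    calc _ ≤ (P.r k ^ 2)⁻¹ * (2 * H * ((d * kappa d + 1) * (δ * P.r k) ^ 2)) := by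
          have := P.side_le_deltaSucc_mul hd k
          refine mul_le_mul_of_nonneg_left (b3.trans ?_) (by positivity)
          gcongr
      _ = _ := by field_simp
  have e : ∑ c ∈ (P.children k z).erase c₀,
        ∫ ζ, kernel d Ω (x - ζ) ∂(P.treeMeasure n (k + 1) c) =
      ∑ c ∈ (P.children k z).erase c₀,
        ((∫ ζ, kernel d Ω (x - ζ) ∂(P.treeMeasure n (k + 1) c)) -
          (P.r k ^ 2)⁻¹ * ∫ ζ in cube d c (P.side k), kernel d Ω (x - ζ)) +
      ((P.r k ^ 2)⁻¹ * (∫ ζ in P.packing k z, kernel d Ω (x - ζ)) -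
        (P.r k ^ 2)⁻¹ * ∫ ζ in cube d c₀ (P.side k), kernel d Ω (x - ζ)) := by
    rw [Finset.sum_sub_distrib, ← Finset.mul_sum, ← P.sum_setIntegral_cube hz hpack,
      ← Finset.add_sum_erase _ _ hc₀]
    ring
  have mono : ∀ p : ℝ, 2 * (α : ℝ) / d ≤ p → δ ^ p ≤ δ ^ (2 * (α : ℝ) / d) := fun p hp =>
    Real.rpow_le_rpow_of_exponent_ge hδ hδ1 hp
  have m1 := mono α (by
    rw [div_le_iff₀ (by linarith)]
    nlinarith)
  have m2 := mono (2 / (d : ℝ)) (by gcongr; linarith)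
  have m3 := mono 2 (by
    rw [div_le_iff₀ (by linarith)]
    nlinarith)
  rw [e]
  refine (abs_add_le _ _).trans ((add_le_add b1 (abs_sub _ _)).trans ?_)
  calc _ ≤ swapConst d H * packConst d * δ ^ (α : ℝ) +
        (2 * H * (d * kappa d + 1) * (16 * (1 + kappa d) ^ 2) * δ ^ (2 / (d : ℝ)) +
          2 * H * (d * kappa d + 1) * δ ^ (2 : ℝ)) := by gcongr
    _ ≤ swapConst d H * packConst d * δ ^ (2 * (α : ℝ) / d) +
        (2 * H * (d * kappa d + 1) * (16 * (1 + kappa d) ^ 2) * δ ^ (2 * (α : ℝ) / d) +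
          2 * H * (d * kappa d + 1) * δ ^ (2 * (α : ℝ) / d)) := by gcongr
    _ = _ := by rw [stepConst]; ring

end Construction

end

/-! ### Summation over the scales and passage to the limit -/

section

variable {d : ℕ} {Ω : E d → ℝ} {H α : ℝ≥0}

/-- A bound for the contribution of all scales at which the point is not in one of the balls. -/
def farConst (d : ℕ) (H : ℝ≥0) : ℝ := 2 * H * kappa d + 2 * H * 2 ^ d * cellConst d * packConst d

lemma farConst_nonneg (d : ℕ) (H : ℝ≥0) : 0 ≤ farConst d H := by
  have := kappa_pos d
  have := cellConst_pos d
  have := packConst_pos d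
  unfold farConst; positivity

lemma stepConst_nonneg (d : ℕ) (H : ℝ≥0) : 0 ≤ Construction.stepConst d H := by
  have := kappa_pos d
  have := swapConst_nonneg d H
  have := packConst_pos d
  unfold Construction.stepConst; positivity

namespace Construction

variable (P : Construction d (scaleRatio d))

/-- The potential of the descendants of a ball. Along the chain of nested balls that contain `x` the
generations contribute a summable series; the other balls contribute a bounded amount. -/
theorem abs_integral_treeMeasure_kernel_le (h : IsAdmissible H α Ω) (hd : 3 ≤ d) (x : E d) (n : ℕ) :
    ∀ {k : ℕ} {z : E d}, z ∈ P.centers k →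
      (∀ w ∈ P.centers (k + n), 3 * P.r (k + n) ≤ ‖x - w‖) →
      |∫ ζ, kernel d Ω (x - ζ) ∂(P.treeMeasure n k z)| ≤ farConst d H +
        stepConst d H * ∑ i ∈ Finset.range n, deltaSucc d P.r (k + i) ^ (2 * (α : ℝ) / d) := by
  classical
  have hκ := kappa_pos d
  have hcell := cellConst_pos d
  have hpack := packConst_pos d
  have hstep := stepConst_nonneg d H
  have hfar : 2 * H * kappa d ≤ farConst d H := by
    unfold farConst
    have : 0 ≤ 2 * H * 2 ^ d * cellConst d * packConst d := by positivity
    linarith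
  have hsum0 : ∀ (n k : ℕ),
      0 ≤ ∑ i ∈ Finset.range n, deltaSucc d P.r (k + i) ^ (2 * (α : ℝ) / d) := fun n k =>
    Finset.sum_nonneg fun i _ => Real.rpow_nonneg (P.deltaSucc_pos hd _).le _
  induction n with
  | zero =>
    intro k z hz hx
    simpa using (P.abs_integral_kernel_far_le h hd 0 hz (hx z hz)).trans hfar
  | succ n ih =>
    intro k z hz hx
    have hs1 := mul_nonneg hstep (hsum0 (n + 1) k)
    by_cases hzfar : 3 * P.r k ≤ ‖x - z‖
    · linarith [P.abs_integral_kernel_far_le h hd (n + 1) hz hzfar]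
    obtain ⟨c₀, hc₀, hnear⟩ := P.exists_nearest_child hz x
    have hc₀' := P.mem_centers_succ.2 ⟨z, hz, hc₀⟩
    rw [treeMeasure_succ, integral_finsetSum_measure
      fun c _ => P.integrable_kernel_treeMeasure h hd n (k + 1) x c,
      ← Finset.add_sum_erase _ _ hc₀]
    refine (abs_add_le _ _).trans ?_
    by_cases hcfar : 3 * P.r (k + 1) ≤ ‖x - c₀‖
    · have b1 := P.abs_integral_kernel_far_le h hd n hc₀' hcfar
      have b2 := P.abs_sum_children_le h hd n hz (x := x) ((P.children k z).erase_subset c₀)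
        fun c hc => hnear c (Finset.mem_of_mem_erase hc) (Finset.ne_of_mem_erase hc)
      have e : farConst d H = 2 * H * kappa d + 2 * H * 2 ^ d * cellConst d * packConst d := rfl
      linarith
    · have hxz : ‖x - z‖ ≤ (1 + 2 * deltaSucc d P.r k) * P.r k := by
        have h1 := P.norm_child_sub_le hz hc₀
        have h2 := P.side_le_deltaSucc_mul hd k
        have h3 := P.eight_mul_r_succ_le_side hd k
        have h4 := P.r_pos (k + 1)
        have h5 := norm_add_le (x - c₀) (c₀ - z)
        rw [sub_add_sub_cancel] at h5
        linarith
      have b1 := ih hc₀' (by rwa [Nat.add_assoc, Nat.add_comm 1 n])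
      have b2 := P.abs_sum_erase_le h hd n hz hc₀ hxz hnear
      have e : ∑ i ∈ Finset.range (n + 1), deltaSucc d P.r (k + i) ^ (2 * (α : ℝ) / d) =
          ∑ i ∈ Finset.range n, deltaSucc d P.r (k + 1 + i) ^ (2 * (α : ℝ) / d) +
            deltaSucc d P.r k ^ (2 * (α : ℝ) / d) := by
        rw [Finset.sum_range_succ', Nat.add_zero]
        congr 1
        refine Finset.sum_congr rfl fun i _ => ?_
        rw [Nat.add_assoc, Nat.add_comm 1 i]
      rw [e, mul_add]
      linarith

instance isFiniteMeasure_approx (m : ℕ) : IsFiniteMeasure (P.approx m) := by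
  refine ⟨?_⟩
  rw [approx, Measure.finsetSum_apply]
  refine ENNReal.sum_lt_top.2 fun z _ => ?_
  rw [Measure.smul_apply, Measure.restrict_apply_univ, smul_eq_mul]
  exact ENNReal.mul_lt_top ENNReal.ofReal_lt_top measure_closedBall_lt_top

/-- Every ball of the construction is close to the support of the limit measure. -/
lemma exists_mem_support (hd : 3 ≤ d) {μ : Measure (E d)} (hμ : P.IsWeakLimit μ) {m : ℕ} {z : E d}
    (hz : z ∈ P.centers m) : ∃ y ∈ μ.support, ‖y - z‖ ≤ 2 * P.r m := by
  by_contra! hcon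
  have hκ := kappa_pos d
  have hr := P.r_pos m
  have hdisj : Disjoint μ.support (closedBall z (2 * P.r m)) := by
    rw [Set.disjoint_left]
    intro y hy hy'
    rw [mem_closedBall, dist_eq_norm] at hy'
    exact absurd hy' (not_le.2 (hcon y hy))
  obtain ⟨f, hf0, hf1, hf⟩ :=
    exists_continuous_zero_one_of_isClosed Measure.isClosed_support isClosed_closedBall hdisj
  let F : E d →ᵇ ℝ := BoundedContinuousFunction.ofNormedAddCommGroup f f.continuous 1
    fun y => by rw [Real.norm_of_nonneg (hf y).1]; exact (hf y).2
  obtain ⟨φ, hφ, hlim⟩ := hμ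
  have hzero : ∫ y, F y ∂μ = 0 :=
    integral_eq_zero_of_ae (by filter_upwards [Measure.support_mem_ae] with y hy using hf0 hy)
  have hge : ∀ᶠ n in atTop, kappa d * P.r m ^ (d - 2) ≤ ∫ y, F y ∂(P.approx (φ n)) := by
    filter_upwards [eventually_ge_atTop m] with n hn
    obtain ⟨j, hj⟩ := Nat.exists_eq_add_of_le (hn.trans hφ.le_apply)
    have hle := P.treeMeasure_le_approx hd j hz
    rw [← hj] at hle
    have := P.isFiniteMeasure_treeMeasure hd j hz
    calc kappa d * P.r m ^ (d - 2) = ∫ _y, (1 : ℝ) ∂(P.treeMeasure j m z) := by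
          rw [integral_const, P.treeMeasure_real_univ hd j hz, smul_eq_mul, mul_one]
      _ = ∫ y, F y ∂(P.treeMeasure j m z) := by
          refine integral_congr_ae ?_
          filter_upwards [mem_ae_iff.2 (P.treeMeasure_compl_closedBall hd j hz)] with y hy
          exact (hf1 hy).symm
      _ ≤ ∫ y, F y ∂(P.approx (φ n)) :=
          integral_mono_measure hle (Eventually.of_forall fun y => (hf y).1)
            (F.integrable _)
  have := ge_of_tendsto (hlim F) hge
  rw [hzero] at this
  have : 0 < kappa d * P.r m ^ (d - 2) := by positivity
  linarith

lemma infDist_support_le (hd : 3 ≤ d) {μ : Measure (E d)} (hμ : P.IsWeakLimit μ) {m : ℕ} {z : E d}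
    (hz : z ∈ P.centers m) (x : E d) : infDist x μ.support ≤ ‖x - z‖ + 2 * P.r m := by
  obtain ⟨y, hy, hyz⟩ := P.exists_mem_support hd hμ hz
  refine (infDist_le_dist_of_mem hy).trans ?_
  rw [dist_eq_norm]
  have := norm_add_le (x - z) (z - y)
  rw [sub_add_sub_cancel, norm_sub_rev z y] at this
  linarith

lemma antitone_r : Antitone P.r :=
  antitone_nat_of_succ_le fun k => by linarith [P.eight_mul_r_succ_le k, P.r_pos (k + 1)]

lemma exists_r_lt {η : ℝ} (hη : 0 < η) : ∃ m, P.r m < η := by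
  have hle : ∀ k, P.r k ≤ (1 / 8) ^ k := by
    intro k
    induction k with
    | zero => simp [P.r_zero]
    | succ k ih =>
      have := P.eight_mul_r_succ_le k
      rw [pow_succ]
      linarith
  obtain ⟨m, hm⟩ := exists_pow_lt_of_lt_one hη (by norm_num : (1 / 8 : ℝ) < 1)
  exact ⟨m, (hle m).trans_lt hm⟩

/-- The potential of an approximating measure, at a point whose distance to the support of the
limit measure is large compared with the radius of the balls. -/
lemma abs_integral_approx_le (h : IsAdmissible H α Ω) (hd : 3 ≤ d) {S : ℝ}
    (hsum : Summable fun k => deltaSucc d P.r k ^ (2 * (α : ℝ) / d))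
    (hS : ∑' k, deltaSucc d P.r k ^ (2 * (α : ℝ) / d) ≤ S) {μ : Measure (E d)}
    (hμ : P.IsWeakLimit μ) {x : E d} {m : ℕ} (hm : P.r m < infDist x μ.support / (2 * d)) :
    |∫ ζ, kernel d Ω (x - ζ) ∂(P.approx m)| ≤ farConst d H + stepConst d H * S := by
  have hd3 : (3 : ℝ) ≤ d := by exact_mod_cast hd
  have hr := P.r_pos m
  have hstep := stepConst_nonneg d H
  rw [P.approx_eq_treeMeasure hd]
  rw [lt_div_iff₀ (by positivity)] at hm
  refine (P.abs_integral_treeMeasure_kernel_le h hd x m P.zero_mem_centers ?_).trans ?_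
  · intro w hw
    rw [zero_add] at hw ⊢
    have := P.infDist_support_le hd hμ hw x
    nlinarith
  · gcongr
    simp only [zero_add]
    exact (hsum.sum_le_tsum _ fun i _ => Real.rpow_nonneg (P.deltaSucc_pos hd i).le _).trans hS

lemma integrable_approx (h : IsAdmissible H α Ω) (hd : 3 ≤ d) (x : E d) (m : ℕ) :
    Integrable (fun ζ => kernel d Ω (x - ζ)) (P.approx m) := by
  rw [P.approx_eq_treeMeasure hd]
  exact P.integrable_kernel_treeMeasure h hd m 0 x 0

lemma approx_ball_eq_zero (hd : 3 ≤ d) {μ : Measure (E d)} (hμ : P.IsWeakLimit μ) {x : E d} {m : ℕ}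
    (hm : P.r m < infDist x μ.support / (2 * d)) :
    P.approx m (ball x (infDist x μ.support / 2)) = 0 := by
  have hd3 : (3 : ℝ) ≤ d := by exact_mod_cast hd
  have hr := P.r_pos m
  rw [lt_div_iff₀ (by positivity)] at hm
  rw [approx, Measure.finsetSum_apply]
  refine Finset.sum_eq_zero fun z hz => ?_
  rw [Measure.smul_apply, Measure.restrict_apply measurableSet_ball]
  have : Disjoint (ball x (infDist x μ.support / 2)) (closedBall z (P.r m)) := by
    apply ball_disjoint_closedBall
    have := P.infDist_support_le hd hμ hz x
    rw [dist_eq_norm]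
    nlinarith
  simp [this.inter_eq]

end Construction

/-- Away from its singularity, the kernel agrees with a bounded continuous function. -/
lemma IsAdmissible.exists_boundedContinuous (h : IsAdmissible H α Ω) (hd : 3 ≤ d) (x : E d) {η : ℝ}
    (hη : 0 < η) : ∃ g : E d →ᵇ ℝ, ∀ ζ ∉ ball x η, g ζ = kernel d Ω (x - ζ) := by
  have hd3 : (3 : ℝ) ≤ d := by exact_mod_cast hd
  have hdisj : Disjoint (closedBall x (η / 2)) (ball x η)ᶜ :=
    Set.disjoint_compl_right_iff_subset.2 (closedBall_subset_ball (by linarith))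
  obtain ⟨f, hf0, hf1, hf⟩ :=
    exists_continuous_zero_one_of_isClosed isClosed_closedBall isOpen_ball.isClosed_compl hdisj
  have hcont : Continuous fun ζ => f ζ * kernel d Ω (x - ζ) := by
    rw [continuous_iff_continuousAt]
    intro ζ
    rcases eq_or_ne ζ x with rfl | hne
    · have : (fun _ : E d => (0 : ℝ)) =ᶠ[𝓝 ζ] fun ξ => f ξ * kernel d Ω (ζ - ξ) := by
        filter_upwards [closedBall_mem_nhds ζ (by linarith : 0 < η / 2)] with ξ hξ
        rw [hf0 hξ, Pi.zero_apply, zero_mul]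
      exact continuousAt_const.congr this
    · refine f.continuous.continuousAt.mul ?_
      have h1 : ContinuousAt (kernel d Ω) (x - ζ) :=
        (continuousOn_kernel h.pos h.holder).continuousAt
          (isOpen_compl_singleton.mem_nhds (sub_ne_zero.2 hne.symm))
      exact ContinuousAt.comp (f := fun ζ => x - ζ) h1 (by fun_prop)
  refine ⟨BoundedContinuousFunction.ofNormedAddCommGroup _ hcont
    (2 * H * (η / 2) ^ (-((d : ℝ) - 2))) fun ζ => ?_, fun ζ hζ => ?_⟩
  · by_cases hζ : ζ ∈ closedBall x (η / 2)
    · rw [hf0 hζ, Pi.zero_apply, zero_mul, norm_zero]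
      positivity
    · rw [mem_closedBall, dist_eq_norm, norm_sub_rev, not_le] at hζ
      rw [norm_mul, Real.norm_of_nonneg (hf ζ).1, Real.norm_eq_abs]
      refine (mul_le_of_le_one_left (abs_nonneg _) (hf ζ).2).trans ?_
      refine (h.abs_kernel_le hd _).trans ?_
      gcongr ?_ * ?_
      exact Real.rpow_le_rpow_of_nonpos (by linarith) hζ.le (by linarith)
  · change f ζ * kernel d Ω (x - ζ) = _
    rw [hf1 hζ, Pi.one_apply, one_mul]

namespace Construction

variable (P : Construction d (scaleRatio d))

/-- Off the support of the limit measure, the bound for the approximating measures passes to the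
limit. -/
lemma abs_integral_limit_le (h : IsAdmissible H α Ω) (hd : 3 ≤ d) {S : ℝ}
    (hsum : Summable fun k => deltaSucc d P.r k ^ (2 * (α : ℝ) / d))
    (hS : ∑' k, deltaSucc d P.r k ^ (2 * (α : ℝ) / d) ≤ S) {μ : Measure (E d)} [IsFiniteMeasure μ]
    (hμ : P.IsWeakLimit μ) {x : E d} (hx : x ∉ μ.support) :
    Integrable (fun ζ => kernel d Ω (x - ζ)) μ ∧
      |∫ ζ, kernel d Ω (x - ζ) ∂μ| ≤ farConst d H + stepConst d H * S := by
  have hd3 : (3 : ℝ) ≤ d := by exact_mod_cast hd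
  obtain ⟨y, hy, -⟩ := P.exists_mem_support hd hμ P.zero_mem_centers
  set ε := infDist x μ.support with hε
  have hε0 : 0 < ε := (Measure.isClosed_support.notMem_iff_infDist_pos ⟨y, hy⟩).1 hx
  obtain ⟨g, hg⟩ := h.exists_boundedContinuous hd x (half_pos hε0)
  have hgμ : ⇑g =ᵐ[μ] fun ζ => kernel d Ω (x - ζ) := by
    filter_upwards [Measure.support_mem_ae] with ζ hζ
    refine hg ζ fun hmem => ?_
    have h1 := infDist_le_dist_of_mem (x := x) hζ
    rw [mem_ball, dist_comm] at hmem
    linarith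
  refine ⟨(g.integrable μ).congr hgμ, ?_⟩
  rw [← integral_congr_ae hgμ]
  obtain ⟨m, hm⟩ := P.exists_r_lt (η := ε / (2 * d)) (by positivity)
  obtain ⟨φ, hφ, hlim⟩ := id hμ
  refine le_of_tendsto (hlim g).abs ?_
  filter_upwards [eventually_ge_atTop m] with n hn
  have hr : P.r (φ n) < ε / (2 * d) := (P.antitone_r (hn.trans hφ.le_apply)).trans_lt hm
  have hgn : ⇑g =ᵐ[P.approx (φ n)] fun ζ => kernel d Ω (x - ζ) := by
    have h0 := P.approx_ball_eq_zero hd hμ hr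
    rw [← compl_compl (ball x _)] at h0
    filter_upwards [mem_ae_iff.2 h0] with ζ hζ using hg ζ hζ
  rw [integral_congr_ae hgn]
  exact P.abs_integral_approx_le h hd hsum hS hμ hr

end Construction

end

end EvenSIO

end

theorem proposition4p1 (d : ℕ) (hd : 3 ≤ d) :
    ∃ B : ℝ, 1 < B ∧
      ∀ (α H : ℝ≥0) (S : ℝ), 0 < α → α ≤ 1 →
        ∃ C : ℝ, 0 < C ∧
          ∀ Ω : EvenSIO.E d → ℝ,
            EvenSIO.EvenOnSphere d Ω →
            HolderOnWith H α Ω (sphere (0 : EvenSIO.E d) 1) →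
            EvenSIO.MeanZero d Ω →
            EvenSIO.MomentCondition d Ω →
          ∀ P : EvenSIO.Construction d B,
            Summable (fun k => EvenSIO.deltaSucc d P.r k ^ (2 * (α : ℝ) / d)) →
            ∑' k, EvenSIO.deltaSucc d P.r k ^ (2 * (α : ℝ) / d) ≤ S →
          ∀ (μ : Measure (EvenSIO.E d)) [IsFiniteMeasure μ],
            P.IsWeakLimit μ →
            (∀ (x : EvenSIO.E d) (ε : ℝ), infDist x μ.support = ε → 0 < ε →
              ∀ m : ℕ, P.r m < ε / (2 * d) →
                Integrable (fun ζ => EvenSIO.kernel d Ω (x - ζ)) (P.approx m) ∧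
                |∫ ζ, EvenSIO.kernel d Ω (x - ζ) ∂(P.approx m)| ≤ C) ∧
            (∀ x : EvenSIO.E d, x ∉ μ.support →
                Integrable (fun ζ => EvenSIO.kernel d Ω (x - ζ)) μ ∧
                |∫ ζ, EvenSIO.kernel d Ω (x - ζ) ∂μ| ≤ C) := by
  refine ⟨EvenSIO.scaleRatio d, by linarith [EvenSIO.eight_le_scaleRatio d],
    fun α H S hα hα1 => ?_⟩
  have hfar := EvenSIO.farConst_nonneg d H
  have hstep := EvenSIO.stepConst_nonneg d H
  have hle : EvenSIO.farConst d H + EvenSIO.Construction.stepConst d H * S ≤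
      EvenSIO.farConst d H + EvenSIO.Construction.stepConst d H * |S| + 1 := by
    have := mul_le_mul_of_nonneg_left (le_abs_self S) hstep
    linarith
  refine ⟨EvenSIO.farConst d H + EvenSIO.Construction.stepConst d H * |S| + 1, by positivity, ?_⟩
  intro Ω heven hΩ h0 h2 P hsum hS μ _ hμ
  have h : EvenSIO.IsAdmissible H α Ω := ⟨hα, hα1, heven, hΩ, h0, h2⟩
  refine ⟨fun x ε hε _ m hm => ⟨P.integrable_approx h hd x m, ?_⟩, fun x hx => ?_⟩
  · rw [← hε] at hm
    exact (P.abs_integral_approx_le h hd hsum hS hμ hm).trans hle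
  · obtain ⟨hint, hbound⟩ := P.abs_integral_limit_le h hd hsum hS hμ hx
    exact ⟨hint, hbound.trans hle⟩
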